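/- Let $\beta>0$ and $\alpha>-\tfrac12$. Let $\Omega$ be the set of continuous functions $\omega:[0,\infty)\to\mathbb{R}$, let $X_t(\omega)=\omega(t)$ be the coordinate process, let $\mathcal F=\sigma(X_t\mid t\ge 0)$, and let $\mathbb{P}$ be a probability measure on $(\Omega,\mathcal F)$ under which $X$ is a centered Gaussian process that is $\beta$-self-similar, i.e. for every $a>0$ the processes $(X_{at})_{t\ge0}$ and $(a^\beta X_t)_{t\ge0}$ have the same finite-dimensional distributions; thus $(\Omega,\mathcal F,\mathbb{P})$ is the coordinate space of a continuous centered $\beta$-self-similar Gaussian process. Then the following hold. (i) $\mathbb{P}$-almost surely, for all $t>0$ the integrals $\int_0^t s^{\alpha-\beta-\frac12}X_s\,ds$ and $\int_t^\infty X_s\,s^{-\beta-\alpha-\frac32}\,ds$ converge absolutely. For each $t>0$ they are square-integrable random variables, and they are the $L^2(\mathbb{P})$-limits, as $\varepsilon\downarrow0$ and as $r\to\infty$ respectively, of the integrals of the same integrands over $[\varepsilon,t]$ and $[t,r]$, which in turn are $L^2(\mathbb{P})$-limits of Riemann sums as the mesh tends to $0$. (ii) The transformation $$\mathcal Z^\alpha_t(X)=X_t-(2\alpha+1)\,t^{\beta-\alpha-\frac12}\int_0^t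 s^{\alpha-\beta-\frac12}X_s\,ds,\qquad t\ge0,$$ is an automorphism of $(\Omega,\mathcal F,\mathbb{P})$, and its inverse is $$\mathcal Z^{\alpha,-1}_t(X)=X_t-(2\alpha+1)\,t^{\alpha+\beta+\frac12}\int_t^\infty X_s\,s^{-\beta-\alpha-\frac32}\,ds,\qquad t\ge0,$$ where the second terms on the right are read as $0$ for $t=0$. That is, there is a bijection $\mathcal Z:\Omega\to\Omega$, measurable with measurable inverse and preserving $\mathbb{P}$, such that for $\mathbb{P}$-almost every $\omega$ one has, for all $t\ge0$, $\mathcal Z(\omega)(t)=\mathcal Z^{\alpha}_t(X)(\omega)$ and $\mathcal Z^{-1}(\omega)(t)=\mathcal Z^{\alpha,-1}_t(X)(\omega)$. -/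

import Mathlib

open MeasureTheory ProbabilityTheory Filter Topology Set
open scoped NNReal ENNReal

noncomputable section

/-- The set of continuous functions `ω : [0,∞) → ℝ`. -/
abbrev PathSpace : Type := C(ℝ≥0, ℝ)

/-- The σ-algebra on the path space generated by the coordinate maps `ω ↦ ω t`, `t ∈ [0,∞)`. -/
instance instMeasurableSpacePathSpace : MeasurableSpace PathSpace :=
  MeasurableSpace.comap (fun (ω : PathSpace) (t : ℝ≥0) => ω t) MeasurableSpace.pi

/-- The coordinate process `X_t(ω) = ω(t)`. -/
def coordProcess (t : ℝ≥0) (ω : PathSpace) : ℝ := ω t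

/-- `(X_{at})_t` and `(a^β X_t)_t` have the same finite-dimensional distributions, for all
`a > 0`. -/
def IsSelfSimilar {Ω : Type*} [MeasurableSpace Ω] (X : ℝ≥0 → Ω → ℝ) (β : ℝ) (P : Measure Ω) :
    Prop :=
  ∀ a : ℝ≥0, 0 < a → ∀ I : Finset ℝ≥0,
    IdentDistrib (fun ω => I.restrict (fun t => X (a * t) ω))
      (fun ω => I.restrict (fun t => (a : ℝ) ^ β * X t ω)) P P

/-- `P` is a probability measure on the path space under which the coordinate process is a centered
`β`-self-similar Gaussian process. In other words, the path space with its σ-algebra and `P` is the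
coordinate space of a continuous centered `β`-self-similar Gaussian process. -/
structure IsSelfSimilarGaussianLaw (β : ℝ) (P : Measure PathSpace) : Prop where
  isProbabilityMeasure : IsProbabilityMeasure P
  isGaussianProcess : IsGaussianProcess coordProcess P
  centered : ∀ t : ℝ≥0, ∫ ω, coordProcess t ω ∂P = 0
  selfSimilar : IsSelfSimilar coordProcess β P

/-- The integrand `s ^ (α - β - 1/2) * X_s`, `s > 0`. -/
def fwdIntegrand (α β : ℝ) (s : ℝ) (ω : PathSpace) : ℝ :=
  s ^ (α - β - 1 / 2) * ω s.toNNReal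

/-- The integrand `X_s * s ^ (-β - α - 3/2)`, `s > 0`. -/
def invIntegrand (α β : ℝ) (s : ℝ) (ω : PathSpace) : ℝ :=
  ω s.toNNReal * s ^ (-β - α - 3 / 2)

/-- `X_t - (2α+1) t^(β-α-1/2) ∫_0^t s^(α-β-1/2) X_s ds`. At `t = 0` this is `X_0`. -/
def fwdTransform (α β : ℝ) (ω : PathSpace) (t : ℝ≥0) : ℝ :=
  ω t - (2 * α + 1) * (t : ℝ) ^ (β - α - 1 / 2) *
    ∫ s in Ioc (0 : ℝ) t, fwdIntegrand α β s ω

/-- `X_t - (2α+1) t^(α+β+1/2) ∫_t^∞ X_s s^(-β-α-3/2) ds`. At `t = 0` this is `X_0`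
when `α + β + 1/2 ≠ 0`, since the factor in front of the integral vanishes. -/
def invTransform (α β : ℝ) (ω : PathSpace) (t : ℝ≥0) : ℝ :=
  ω t - (2 * α + 1) * (t : ℝ) ^ (α + β + 1 / 2) *
    ∫ s in Ioi (t : ℝ), invIntegrand α β s ω

/-- `J` is the `L²(P)`-limit, as the mesh tends to `0`, of the Riemann sums of `f` over tagged
partitions `a = p 0 ≤ ξ 0 ≤ p 1 ≤ ξ 1 ≤ ⋯ ≤ p n = b` of `[a, b]`. -/
def IsL2RiemannIntegral {Ω : Type*} [MeasurableSpace Ω] (P : Measure Ω) (f : ℝ → Ω → ℝ)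
    (a b : ℝ) (J : Ω → ℝ) : Prop :=
  MemLp J 2 P ∧
  ∀ ε : ℝ, 0 < ε → ∃ δ : ℝ, 0 < δ ∧
    ∀ (n : ℕ) (p ξ : ℕ → ℝ), p 0 = a → p n = b →
      (∀ i < n, p i ≤ ξ i ∧ ξ i ≤ p (i + 1) ∧ p (i + 1) - p i ≤ δ) →
      eLpNorm (fun ω => (∑ i ∈ Finset.range n, (p (i + 1) - p i) * f (ξ i) ω) - J ω) 2 P
        ≤ ENNReal.ofReal ε

/-- Improper version: `J` is the `L²(P)`-limit, as `r` tends along `l`, of the `L²(P)`-Riemann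
integrals of `f` over `[a r, b r]`. -/
def IsL2ImproperRiemannIntegral {Ω : Type*} [MeasurableSpace Ω] (P : Measure Ω)
    (f : ℝ → Ω → ℝ) (a b : ℝ → ℝ) (l : Filter ℝ) (J : Ω → ℝ) : Prop :=
  MemLp J 2 P ∧
  ∃ K : ℝ → Ω → ℝ,
    (∀ᶠ r in l, a r ≤ b r ∧ IsL2RiemannIntegral P f (a r) (b r) (K r)) ∧
    Tendsto (fun r => eLpNorm (fun ω => K r ω - J ω) 2 P) l (𝓝 0)

end

/-! The Lamperti transform `y u = e^{-βu} X (e^u)` turns self-similarity into stationarity. With `ν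
= α + 1/2` and `s = t e^{σa}`, both transformations become one-sided filters `1 - 2ν A_σ`, where
`A_σ y (u) = ∫_0^∞ e^{-νa} y (u + σa) da`: `σ = -1` for the transformation, `σ = 1` for its inverse.
On the Fourier side `1 - 2ν A_{-1}` multiplies by `(iλ - ν)/(iλ + ν)`, which has modulus one, and `1
- 2ν A_1` multiplies by the conjugate. So the two are mutually inverse and preserve stationary
covariances.

The proof stays in the time domain. Integrating the equation `g' = σ(νg - y)` for `g = A_σ y` gives
the resolvent identity `2ν A_{-σ} A_σ = A_σ + A_{-σ}` (`ExpIntegrable.expAvg_neg_expAvg`), hence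
inversion (`ExpIntegrable.allPass_neg_allPass`). Under stationarity `A_{-σ}` is the adjoint of
`A_σ`, hence isometry (`inner_allPass_allPass`).

The filters act on two kinds of curve: single paths, and `t ↦ X_t` in `L²(P)`.
`ae_integrable_and_coeFn_integral_Lp` identifies the two integrals almost surely. The path version
yields a bijection of the path space (`allPassPath_neg_allPassPath`). The `L²` version keeps the
transformed process in the Gaussian space of `X` with the same covariance, so its law is unchanged
(`measurePreserving_of_inner_eq`). -/

noncomputable section

/-! ### One-sided exponential averages and their all-pass filters. -/

section ExpAvg

variable {E : Type*} [NormedAddCommGroup E] [NormedSpace ℝ E]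

/-- The one-sided exponential average `∫_0^∞ e^{-νa} y (u + σ a) da`. -/
def expAvg (ν σ : ℝ) (y : ℝ → E) (u : ℝ) : E :=
  ∫ a in Ioi (0 : ℝ), Real.exp (-(ν * a)) • y (u + σ * a)

/-- The all-pass filter `y - 2ν ∫_0^∞ e^{-νa} y (· + σ a) da`. -/
def allPass (ν σ : ℝ) (y : ℝ → E) (u : ℝ) : E :=
  y u - (2 * ν) • expAvg ν σ y u

/-- Integrability against the weight `e^{-δ|v|}`. -/
def ExpIntegrable (δ : ℝ) (y : ℝ → E) : Prop :=
  Integrable (fun v => Real.exp (-(δ * |v|)) • y v)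

lemma exp_neg_mul_le_exp_mul_abs {δ ν σ a : ℝ} (hσ : |σ| = 1) (hδ : 0 ≤ δ) (hδν : δ ≤ ν)
    (ha : 0 ≤ a) (u : ℝ) :
    Real.exp (-(ν * a)) ≤ Real.exp (δ * |u|) * Real.exp (-(δ * |u + σ * a|)) := by
  rw [← Real.exp_add]
  apply Real.exp_le_exp.2
  have h1 : |u + σ * a| ≤ |u| + a := by
    calc |u + σ * a| ≤ |u| + |σ * a| := abs_add_le _ _
      _ = |u| + a := by rw [abs_mul, hσ, abs_of_nonneg ha, one_mul]
  nlinarith [mul_le_mul_of_nonneg_left h1 hδ, mul_le_mul_of_nonneg_right hδν ha]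

/-- The factor `e^{-(ν-δ)a}` left over is what makes the integral over `a` converge in the Fubini
argument of `ExpIntegrable.expIntegrable_expAvg`. -/
lemma exp_mul_exp_le {δ ν σ a : ℝ} (hσ : |σ| = 1) (hδ : 0 ≤ δ) (ha : 0 ≤ a) (u : ℝ) :
    Real.exp (-(δ * |u|)) * Real.exp (-(ν * a)) ≤
      Real.exp (-((ν - δ) * a)) * Real.exp (-(δ * |u + σ * a|)) := by
  rw [← Real.exp_add, ← Real.exp_add]
  apply Real.exp_le_exp.2
  have h1 : |u + σ * a| ≤ |u| + a := by
    calc |u + σ * a| ≤ |u| + |σ * a| := abs_add_le _ _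
      _ = |u| + a := by rw [abs_mul, hσ, abs_of_nonneg ha, one_mul]
  nlinarith [mul_le_mul_of_nonneg_left h1 hδ]

omit [NormedSpace ℝ E] in
lemma MeasureTheory.Integrable.comp_add_mul {f : ℝ → E} (hf : Integrable f) {σ : ℝ}
    (hσ : |σ| = 1) (u : ℝ) : Integrable (fun a => f (u + σ * a)) := by
  have hσ0 : σ ≠ 0 := by rintro rfl; simp at hσ
  exact (hf.comp_add_left u).comp_mul_left' hσ0

lemma integral_comp_add_mul (f : ℝ → E) {σ : ℝ} (hσ : |σ| = 1) (u : ℝ) :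
    ∫ a, f (u + σ * a) = ∫ v, f v := by
  rw [Measure.integral_comp_mul_left (fun a => f (u + a)) σ, abs_inv, hσ,
    integral_add_left_eq_self]
  simp

lemma ExpIntegrable.integrableOn {δ ν σ : ℝ} {y : ℝ → E} (hσ : |σ| = 1) (hδ : 0 ≤ δ)
    (hδν : δ ≤ ν) (hy : Continuous y) (h : ExpIntegrable δ y) (u : ℝ) :
    IntegrableOn (fun a => Real.exp (-(ν * a)) • y (u + σ * a)) (Ioi 0) := by
  refine Integrable.mono' (((h.comp_add_mul hσ u).norm.const_mul (Real.exp (δ * |u|))).integrableOn)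
    (Continuous.aestronglyMeasurable (by fun_prop)) ?_
  filter_upwards [ae_restrict_mem measurableSet_Ioi] with a ha
  rw [norm_smul, norm_smul, Real.norm_eq_abs, Real.norm_eq_abs, Real.abs_exp, Real.abs_exp,
    ← mul_assoc]
  exact mul_le_mul_of_nonneg_right
    (exp_neg_mul_le_exp_mul_abs hσ hδ hδν (le_of_lt ha) u) (norm_nonneg _)

/-- This growth bound serves twice: it kills a boundary term at infinity in the resolvent identity,
and it gives continuity of transformed paths at time `0`. -/
lemma ExpIntegrable.norm_expAvg_le {δ ν σ : ℝ} {y : ℝ → E} (hσ : |σ| = 1) (hδ : 0 ≤ δ)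
    (hδν : δ ≤ ν) (h : ExpIntegrable δ y) (u : ℝ) :
    ‖expAvg ν σ y u‖ ≤ Real.exp (δ * |u|) * ∫ v, ‖Real.exp (-(δ * |v|)) • y v‖ := by
  have hint := ((h.comp_add_mul hσ u).norm.const_mul (Real.exp (δ * |u|)))
  calc ‖expAvg ν σ y u‖
      ≤ ∫ a in Ioi (0 : ℝ), Real.exp (δ * |u|) *
          ‖Real.exp (-(δ * |u + σ * a|)) • y (u + σ * a)‖ := by
        refine norm_integral_le_of_norm_le hint.integrableOn ?_
        filter_upwards [ae_restrict_mem measurableSet_Ioi] with a ha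
        rw [norm_smul, norm_smul, Real.norm_eq_abs, Real.norm_eq_abs, Real.abs_exp, Real.abs_exp,
          ← mul_assoc]
        exact mul_le_mul_of_nonneg_right
          (exp_neg_mul_le_exp_mul_abs hσ hδ hδν (le_of_lt ha) u) (norm_nonneg _)
    _ ≤ ∫ a, Real.exp (δ * |u|) * ‖Real.exp (-(δ * |u + σ * a|)) • y (u + σ * a)‖ :=
        setIntegral_le_integral hint (Eventually.of_forall fun a => by positivity)
    _ = _ := by
        rw [integral_const_mul, integral_comp_add_mul
          (fun v => ‖Real.exp (-(δ * |v|)) • y v‖) hσ u]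

/-- Stability of the weighted class lets the two filters be composed. By Fubini and translation
invariance the weighted norm grows at most by the factor `∫_0^∞ e^{-(ν-δ)a} da`, finite since `δ <
ν`. -/
lemma ExpIntegrable.expIntegrable_expAvg {δ ν σ : ℝ} {y : ℝ → E} (hσ : |σ| = 1) (hδ : 0 ≤ δ)
    (hδν : δ < ν) (hy : Continuous y) (h : ExpIntegrable δ y) :
    ExpIntegrable δ (expAvg ν σ y) := by
  have hm : AEStronglyMeasurable (fun p : ℝ × ℝ =>
      Real.exp (-(δ * |p.1|)) • Real.exp (-(ν * p.2)) • y (p.1 + σ * p.2))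
      (volume.prod (volume.restrict (Ioi 0))) :=
    Continuous.aestronglyMeasurable (by fun_prop)
  have hdom (u a : ℝ) (ha : 0 ≤ a) :
      ‖Real.exp (-(δ * |u|)) • Real.exp (-(ν * a)) • y (u + σ * a)‖ ≤
      Real.exp (-((ν - δ) * a)) * ‖Real.exp (-(δ * |u + σ * a|)) • y (u + σ * a)‖ := by
    rw [norm_smul, norm_smul, norm_smul]
    simp only [Real.norm_eq_abs, Real.abs_exp]
    rw [← mul_assoc, ← mul_assoc]
    exact mul_le_mul_of_nonneg_right (exp_mul_exp_le hσ hδ ha u) (norm_nonneg _)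
  have hshift (a : ℝ) : Integrable (fun u => Real.exp (-((ν - δ) * a)) *
      ‖Real.exp (-(δ * |u + σ * a|)) • y (u + σ * a)‖) :=
    (Integrable.comp_add_right (f := fun v => ‖Real.exp (-(δ * |v|)) • y v‖) h.norm
      (σ * a)).const_mul _
  have hprod : Integrable (fun p : ℝ × ℝ =>
      Real.exp (-(δ * |p.1|)) • Real.exp (-(ν * p.2)) • y (p.1 + σ * p.2))
      (volume.prod (volume.restrict (Ioi 0))) := by
    rw [integrable_prod_iff' hm]
    constructor
    · filter_upwards [ae_restrict_mem measurableSet_Ioi] with a ha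
      exact (hshift a).mono' (Continuous.aestronglyMeasurable (by fun_prop))
        (Eventually.of_forall fun u => hdom u a (le_of_lt ha))
    · have hexp : IntegrableOn (fun a : ℝ => Real.exp (-((ν - δ) * a)) *
          ∫ v, ‖Real.exp (-(δ * |v|)) • y v‖) (Ioi 0) := by
        refine Integrable.mul_const ?_ _
        have h1 := exp_neg_integrableOn_Ioi 0 (sub_pos.2 hδν)
        simp only [neg_mul] at h1
        exact h1
      refine hexp.mono' hm.norm.prod_swap.integral_prod_right' ?_
      filter_upwards [ae_restrict_mem measurableSet_Ioi] with a ha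
      rw [Real.norm_of_nonneg (integral_nonneg fun _ => norm_nonneg _)]
      refine (integral_mono_of_nonneg (Eventually.of_forall fun _ => norm_nonneg _) (hshift a)
        (Eventually.of_forall fun u => hdom u a (le_of_lt ha))).trans_eq ?_
      rw [integral_const_mul,
        integral_add_right_eq_self (fun v => ‖Real.exp (-(δ * |v|)) • y v‖) (σ * a)]
  refine hprod.integral_prod_left.congr (Eventually.of_forall fun u => ?_)
  simp only [expAvg]
  rw [integral_smul]

lemma ExpIntegrable.expIntegrable_allPass {δ ν σ : ℝ} {y : ℝ → E} (hσ : |σ| = 1) (hδ : 0 ≤ δ)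
    (hδν : δ < ν) (hy : Continuous y) (h : ExpIntegrable δ y) :
    ExpIntegrable δ (allPass ν σ y) := by
  refine (Integrable.sub h ((h.expIntegrable_expAvg hσ hδ hδν hy).smul (2 * ν))).congr
    (Eventually.of_forall fun u => ?_)
  simp [allPass, smul_sub, smul_comm (2 * ν)]

lemma expAvg_comp_neg (ν σ : ℝ) (y : ℝ → E) (u : ℝ) :
    expAvg ν σ (fun v => y (-v)) u = expAvg ν (-σ) y (-u) := by
  unfold expAvg
  congr 1
  ext a
  dsimp only
  rw [neg_add, neg_mul]

lemma ExpIntegrable.comp_neg {δ : ℝ} {y : ℝ → E} (h : ExpIntegrable δ y) :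
    ExpIntegrable δ (fun v => y (-v)) := by
  have := Integrable.comp_neg h
  simpa [ExpIntegrable] using this

/-- Translation moves `u` out of the integrand into a prefactor and an endpoint, where the
fundamental theorem of calculus applies. -/
lemma expAvg_one_eq (ν : ℝ) (y : ℝ → E) (u : ℝ) :
    expAvg ν 1 y u = Real.exp (ν * u) • ∫ v in Ioi u, Real.exp (-(ν * v)) • y v := by
  have h1 : ∫ v in Ioi u, Real.exp (-(ν * v)) • y v =
      ∫ a in Ioi (0 : ℝ), Real.exp (-(ν * (u + a))) • y (u + a) := by
    have he : MeasurableEmbedding (fun a : ℝ => u + a) := measurableEmbedding_addLeft u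
    have hmp : MeasurePreserving (fun a : ℝ => u + a) := measurePreserving_add_left volume u
    rw [← hmp.setIntegral_preimage_emb he]
    simp
  rw [h1, ← integral_smul]
  unfold expAvg
  congr 1
  ext a
  rw [smul_smul, ← Real.exp_add, one_mul]
  congr 2
  ring

lemma ExpIntegrable.hasDerivAt_expAvg_one [CompleteSpace E] {δ ν : ℝ} {y : ℝ → E} (hδ : 0 ≤ δ)
    (hδν : δ ≤ ν) (hy : Continuous y) (h : ExpIntegrable δ y) (u : ℝ) :
    HasDerivAt (expAvg ν 1 y) (ν • expAvg ν 1 y u - y u) u := by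
  have hIoi (w : ℝ) : IntegrableOn (fun v => Real.exp (-(ν * v)) • y v) (Ioi w) := by
    rcases le_total 0 w with hw | hw
    · have := h.integrableOn (σ := 1) (by simp) hδ hδν hy 0
      simp only [zero_add, one_mul] at this
      exact this.mono_set (Ioi_subset_Ioi hw)
    · have := h.integrableOn (σ := 1) (by simp) hδ hδν hy 0
      simp only [zero_add, one_mul] at this
      rw [← Ioc_union_Ioi_eq_Ioi hw]
      exact IntegrableOn.union ((Continuous.integrableOn_Icc (by fun_prop)).mono_set
        Ioc_subset_Icc_self) this
  have hG : HasDerivAt (fun u => ∫ v in Ioi u, Real.exp (-(ν * v)) • y v)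
      (-(Real.exp (-(ν * u)) • y u)) u := by
    have hc : Continuous (fun v => Real.exp (-(ν * v)) • y v) := by fun_prop
    have h2 : (fun u => ∫ v in Ioi u, Real.exp (-(ν * v)) • y v) = fun u =>
        (∫ v in Ioi 0, Real.exp (-(ν * v)) • y v) -
          ∫ v in (0 : ℝ)..u, Real.exp (-(ν * v)) • y v := by
      ext w
      rw [← intervalIntegral.integral_Ioi_sub_Ioi' (hIoi 0) (hIoi w)]
      abel
    rw [h2]
    exact (intervalIntegral.integral_hasDerivAt_right (hc.intervalIntegrable _ _)
      (hc.stronglyMeasurableAtFilter _ _) hc.continuousAt).const_sub _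
  have hE : HasDerivAt (fun u => Real.exp (ν * u)) (ν * Real.exp (ν * u)) u := by
    simpa [mul_comm] using ((hasDerivAt_id u).const_mul ν).exp
  have := hE.smul hG
  rw [show expAvg ν 1 y = fun u => Real.exp (ν * u) • ∫ v in Ioi u, Real.exp (-(ν * v)) • y v
    from funext (expAvg_one_eq ν y)]
  convert! this using 1
  rw [smul_neg, smul_smul, smul_smul, ← Real.exp_add]
  simp
  abel

lemma eq_one_or_neg_one_of_abs {σ : ℝ} (hσ : |σ| = 1) : σ = 1 ∨ σ = -1 :=
  eq_or_eq_neg_of_abs_eq hσ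

/-- The reflection `v ↦ -v` exchanges the two directions and reduces `σ = -1` to `σ = 1`. -/
lemma ExpIntegrable.hasDerivAt_expAvg [CompleteSpace E] {δ ν σ : ℝ} {y : ℝ → E} (hσ : |σ| = 1)
    (hδ : 0 ≤ δ) (hδν : δ ≤ ν) (hy : Continuous y) (h : ExpIntegrable δ y) (u : ℝ) :
    HasDerivAt (expAvg ν σ y) (σ • (ν • expAvg ν σ y u - y u)) u := by
  rcases eq_one_or_neg_one_of_abs hσ with rfl | rfl
  · simpa using h.hasDerivAt_expAvg_one hδ hδν hy u
  · have h1 := h.comp_neg.hasDerivAt_expAvg_one hδ hδν (by fun_prop) (-u)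
    have h2 := h1.scomp u (hasDerivAt_neg u)
    simp only [expAvg_comp_neg, neg_neg] at h2
    convert! h2 using 1
    ext v
    simp [expAvg_comp_neg]

lemma ExpIntegrable.continuous_expAvg [CompleteSpace E] {δ ν σ : ℝ} {y : ℝ → E} (hσ : |σ| = 1)
    (hδ : 0 ≤ δ) (hδν : δ ≤ ν) (hy : Continuous y) (h : ExpIntegrable δ y) :
    Continuous (expAvg ν σ y) :=
  continuous_iff_continuousAt.2 fun u => (h.hasDerivAt_expAvg hσ hδ hδν hy u).continuousAt

lemma ExpIntegrable.continuous_allPass [CompleteSpace E] {δ ν σ : ℝ} {y : ℝ → E} (hσ : |σ| = 1)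
    (hδ : 0 ≤ δ) (hδν : δ ≤ ν) (hy : Continuous y) (h : ExpIntegrable δ y) :
    Continuous (allPass ν σ y) :=
  hy.sub ((h.continuous_expAvg hσ hδ hδν hy).const_smul (2 * ν))

/-- The resolvent identity for the two opposite one-sided exponential averages. -/
lemma ExpIntegrable.expAvg_neg_expAvg [CompleteSpace E] {δ ν σ : ℝ} {y : ℝ → E} (hσ : |σ| = 1)
    (hδ : 0 ≤ δ) (hδν : δ < ν) (hy : Continuous y) (h : ExpIntegrable δ y) (u : ℝ) :
    (2 * ν) • expAvg ν (-σ) (expAvg ν σ y) u =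
      expAvg ν σ y u + expAvg ν (-σ) y u := by
  set g := expAvg ν σ y with hg
  have hσ' : |-σ| = 1 := by rwa [abs_neg]
  have hσσ : σ * σ = 1 := by rw [← abs_mul_abs_self, hσ, one_mul]
  have hgc : Continuous g := h.continuous_expAvg hσ hδ hδν.le hy
  have hgi : ExpIntegrable δ g := h.expIntegrable_expAvg hσ hδ hδν hy
  have hgI := hgi.integrableOn hσ' hδ hδν.le hgc u
  have hyI := h.integrableOn hσ' hδ hδν.le hy u
  -- Running against the direction of the average, the equation `g' = σ(νg - y)` contributes a
  -- second `-νg`. Integrated over `(0, ∞)`, this derivative gives `-g(u) = -2ν A_{-σ} g(u) + A_{-σ}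
  -- y(u)`.
  have hder (a : ℝ) : HasDerivAt (fun a => Real.exp (-(ν * a)) • g (u + -σ * a))
      (-((2 * ν) • Real.exp (-(ν * a)) • g (u + -σ * a)) +
        Real.exp (-(ν * a)) • y (u + -σ * a)) a := by
    have hE : HasDerivAt (fun a => Real.exp (-(ν * a))) (-ν * Real.exp (-(ν * a))) a := by
      simpa [mul_comm] using ((hasDerivAt_id a).const_mul ν).neg.exp
    have hlin : HasDerivAt (fun a => u + -σ * a) (-σ) a := by
      simpa using ((hasDerivAt_id a).const_mul (-σ)).const_add u
    have h2 := (h.hasDerivAt_expAvg hσ hδ hδν.le hy (u + -σ * a)).scomp a hlin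
    convert! hE.smul h2 using 1
    rw [← hg, smul_smul (-σ), neg_mul σ σ, hσσ, Function.comp_apply]
    module
  -- The average grows at most like `e^{δa}`, which `e^{-νa}` beats because `δ < ν`.
  have hlim : Tendsto (fun a => Real.exp (-(ν * a)) • g (u + -σ * a)) atTop (𝓝 0) := by
    rw [tendsto_zero_iff_norm_tendsto_zero]
    set C := ∫ v, ‖Real.exp (-(δ * |v|)) • y v‖
    have hC : 0 ≤ C := integral_nonneg fun _ => norm_nonneg _
    have hz : Tendsto (fun a : ℝ => Real.exp (-((ν - δ) * a)) * (Real.exp (δ * |u|) * C))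
        atTop (𝓝 0) := by
      have : Tendsto (fun a : ℝ => Real.exp (-((ν - δ) * a))) atTop (𝓝 0) :=
        Real.tendsto_exp_neg_atTop_nhds_zero.comp (tendsto_id.const_mul_atTop (sub_pos.2 hδν))
      simpa using this.mul_const (Real.exp (δ * |u|) * C)
    refine squeeze_zero' (Eventually.of_forall fun _ => norm_nonneg _) ?_ hz
    filter_upwards [eventually_ge_atTop 0] with a ha
    rw [norm_smul, Real.norm_eq_abs, Real.abs_exp]
    calc Real.exp (-(ν * a)) * ‖g (u + -σ * a)‖
        ≤ Real.exp (-(ν * a)) * (Real.exp (δ * |u + -σ * a|) * C) :=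
          mul_le_mul_of_nonneg_left (h.norm_expAvg_le hσ hδ hδν.le _) (Real.exp_pos _).le
      _ = (Real.exp (-(ν * a)) * Real.exp (δ * |u + -σ * a|)) * C := by ring
      _ ≤ (Real.exp (-((ν - δ) * a)) * Real.exp (δ * |u|)) * C := by
          refine mul_le_mul_of_nonneg_right ?_ hC
          rw [← Real.exp_add, ← Real.exp_add]
          apply Real.exp_le_exp.2
          have h1 : |u + -σ * a| ≤ |u| + a := by
            calc |u + -σ * a| ≤ |u| + |-σ * a| := abs_add_le _ _
              _ = |u| + a := by rw [abs_mul, hσ', abs_of_nonneg ha, one_mul]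
          nlinarith [mul_le_mul_of_nonneg_left h1 hδ]
      _ = _ := by ring
  have hFTC := integral_Ioi_of_hasDerivAt_of_tendsto' (a := 0) (fun a _ => hder a)
    ((hgI.smul (2 * ν)).neg.add hyI) hlim
  have hsplit := integral_add (hgI.smul (2 * ν)).neg hyI
  simp only [Pi.neg_apply, Pi.smul_apply] at hsplit
  rw [hsplit, integral_neg, integral_smul] at hFTC
  simp only [mul_zero, neg_zero, Real.exp_zero, add_zero, one_smul, zero_sub] at hFTC
  change -((2 * ν) • expAvg ν (-σ) g u) + expAvg ν (-σ) y u = -g u at hFTC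
  have := congrArg Neg.neg hFTC
  rw [neg_neg, neg_add, neg_neg] at this
  rw [← this]
  abel

lemma ExpIntegrable.expAvg_sub_smul {δ ν σ : ℝ} {y z : ℝ → E} (hσ : |σ| = 1) (hδ : 0 ≤ δ)
    (hδν : δ ≤ ν) (hy : Continuous y) (h : ExpIntegrable δ y) (hz : Continuous z)
    (h' : ExpIntegrable δ z) (c u : ℝ) :
    expAvg ν σ (fun v => y v - c • z v) u =
      expAvg ν σ y u - c • expAvg ν σ z u := by
  unfold expAvg
  have h1 := integral_sub (h.integrableOn hσ hδ hδν hy u)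
    ((h'.integrableOn hσ hδ hδν hz u).smul c)
  simp only [Pi.smul_apply] at h1
  rw [← integral_smul, ← h1]
  congr 1
  ext a
  rw [smul_sub, smul_comm c]

/-- The two opposite all-pass filters are mutually inverse. -/
theorem ExpIntegrable.allPass_neg_allPass [CompleteSpace E] {δ ν σ : ℝ} {y : ℝ → E}
    (hσ : |σ| = 1) (hδ : 0 ≤ δ) (hδν : δ < ν) (hy : Continuous y) (h : ExpIntegrable δ y) :
    allPass ν (-σ) (allPass ν σ y) = y := by
  ext u
  have hσ' : |-σ| = 1 := by rwa [abs_neg]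
  have h1 := h.expAvg_sub_smul hσ' hδ hδν.le hy (h.continuous_expAvg hσ hδ hδν.le hy)
    (h.expIntegrable_expAvg hσ hδ hδν hy) (2 * ν) u
  have h2 := h.expAvg_neg_expAvg hσ hδ hδν hy u
  change expAvg ν (-σ) (allPass ν σ y) u = _ at h1
  -- By the resolvent identity the product term `4ν² A_{-σ} A_σ` cancels `-2ν(A_σ + A_{-σ})`.
  rw [allPass, h1, h2, allPass]
  module

end ExpAvg

/-! ### All-pass filters on stationary curves in a Hilbert space. -/

section Stationary

variable {H : Type*} [NormedAddCommGroup H] [InnerProductSpace ℝ H] [CompleteSpace H]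

lemma integrable_exp_neg_mul_abs_of_pos {δ : ℝ} (hδ : 0 < δ) :
    Integrable (fun v : ℝ => Real.exp (-(δ * |v|))) := by
  rw [← integrableOn_univ, ← Iic_union_Ioi (a := (0 : ℝ))]
  refine IntegrableOn.union ?_ ?_
  · refine (integrableOn_exp_mul_Iic hδ 0).congr_fun (fun v hv => ?_) measurableSet_Iic
    simp [abs_of_nonpos (mem_Iic.1 hv)]
  · refine (integrableOn_exp_mul_Ioi (neg_lt_zero.2 hδ) 0).congr_fun (fun v hv => ?_)
      measurableSet_Ioi
    simp [abs_of_pos (mem_Ioi.1 hv)]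

lemma expIntegrable_of_norm_le {E : Type*} [NormedAddCommGroup E] [NormedSpace ℝ E] {δ C : ℝ}
    (hδ : 0 < δ) {Y : ℝ → E} (hY : Continuous Y) (hC : ∀ u, ‖Y u‖ ≤ C) : ExpIntegrable δ Y := by
  refine ((integrable_exp_neg_mul_abs_of_pos hδ).mul_const C).mono'
    (Continuous.aestronglyMeasurable (by fun_prop)) (Eventually.of_forall fun v => ?_)
  rw [norm_smul, Real.norm_eq_abs, Real.abs_exp]
  exact mul_le_mul_of_nonneg_left (hC v) (Real.exp_pos _).le

omit [CompleteSpace H] in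
lemma norm_eq_of_stationary {Y : ℝ → H}
    (hst : ∀ u v h : ℝ, inner ℝ (Y (u + h)) (Y (v + h)) = inner ℝ (Y u) (Y v)) (u : ℝ) :
    ‖Y u‖ = ‖Y 0‖ := by
  have := hst 0 0 u
  rw [zero_add, real_inner_self_eq_norm_sq, real_inner_self_eq_norm_sq] at this
  exact (sq_eq_sq₀ (norm_nonneg _) (norm_nonneg _)).1 this

lemma ExpIntegrable.inner_expAvg {δ ν σ : ℝ} {y : ℝ → H} (hσ : |σ| = 1) (hδ : 0 ≤ δ)
    (hδν : δ ≤ ν) (hy : Continuous y) (h : ExpIntegrable δ y) (x : H) (u : ℝ) :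
    inner ℝ x (expAvg ν σ y u) =
      ∫ a in Ioi (0 : ℝ), Real.exp (-(ν * a)) * inner ℝ x (y (u + σ * a)) := by
  have := (innerSL ℝ x).integral_comp_comm (h.integrableOn hσ hδ hδν hy u)
  simp only [map_smul, smul_eq_mul, innerSL_apply_apply] at this
  exact this.symm

/-- An all-pass filter preserves the covariance of a stationary Hilbert-space-valued curve. -/
theorem inner_allPass_allPass {ν σ : ℝ} (hσ : |σ| = 1) (hν : 0 < ν) {Y : ℝ → H}
    (hY : Continuous Y)
    (hst : ∀ u v h : ℝ, inner ℝ (Y (u + h)) (Y (v + h)) = inner ℝ (Y u) (Y v)) (u v : ℝ) :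
    inner ℝ (allPass ν σ Y u) (allPass ν σ Y v) = inner ℝ (Y u) (Y v) := by
  have hδ : 0 < ν / 2 := by positivity
  have hδν : ν / 2 < ν := by linarith
  have hYi : ExpIntegrable (ν / 2) Y :=
    expIntegrable_of_norm_le hδ hY fun u => (norm_eq_of_stationary hst u).le
  have hσ' : |-σ| = 1 := by rwa [abs_neg]
  set V := allPass ν σ Y with hV
  have hVc : Continuous V := hYi.continuous_allPass hσ hδ.le hδν.le hY
  have hVi : ExpIntegrable (ν / 2) V := hYi.expIntegrable_allPass hσ hδ.le hδν hY
  -- The filter commutes with time shifts, so `Y` and `V` are jointly stationary.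
  have hjoint (u v h : ℝ) : inner ℝ (Y (u + h)) (V (v + h)) = inner ℝ (Y u) (V v) := by
    rw [hV, allPass, allPass, inner_sub_right, inner_sub_right, inner_smul_right,
      inner_smul_right, hYi.inner_expAvg hσ hδ.le hδν.le hY, hYi.inner_expAvg hσ hδ.le hδν.le hY,
      hst]
    simp only [add_right_comm v h, hst]
  have hinv : allPass ν (-σ) V v = Y v := by
    rw [hV, hYi.allPass_neg_allPass hσ hδ.le hδν hY]
  -- Shifting both arguments by `-σa` moves the average onto `V` with reversed direction: `A_{-σ}`
  -- acts as the adjoint of `A_σ`.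
  have h1 : inner ℝ (expAvg ν σ Y u) (V v) = inner ℝ (Y u) (expAvg ν (-σ) V v) := by
    rw [real_inner_comm, hYi.inner_expAvg hσ hδ.le hδν.le hY,
      hVi.inner_expAvg hσ' hδ.le hδν.le hVc]
    congr 1
    ext a
    rw [real_inner_comm]
    have := hjoint u (v + -σ * a) (σ * a)
    rw [show v + -σ * a + σ * a = v by ring] at this
    rw [this]
  calc inner ℝ (V u) (V v)
      = inner ℝ (Y u) (V v) - 2 * ν * inner ℝ (expAvg ν σ Y u) (V v) := by
        conv_lhs => rw [hV]
        rw [allPass, inner_sub_left, real_inner_smul_left]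
    _ = inner ℝ (Y u) (allPass ν (-σ) V v) := by
        rw [h1, allPass, inner_sub_right, real_inner_smul_right]
    _ = inner ℝ (Y u) (Y v) := by rw [hinv]

/-- A closed subspace is its own double orthogonal complement, and inner products pass through the
integral. Without integrability the integral is `0`, which also lies in `S`. -/
lemma Submodule.setIntegral_mem {S : Submodule ℝ H} (hS : IsClosed (S : Set H)) {μ : Measure ℝ}
    {A : Set ℝ} {f : ℝ → H} (hf : ∀ a, f a ∈ S) : ∫ a in A, f a ∂μ ∈ S := by
  by_cases hfi : IntegrableOn f A μ
  · have : CompleteSpace S := hS.completeSpace_coe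
    rw [← S.orthogonal_orthogonal, Submodule.mem_orthogonal]
    intro x hx
    have h := (innerSL ℝ x).integral_comp_comm hfi
    simp only [innerSL_apply_apply] at h
    rw [← h]
    simp [fun a => Submodule.inner_left_of_mem_orthogonal (hf a) hx]
  · rw [integral_undef hfi]
    exact S.zero_mem

end Stationary

/-! ### Riemann sums of vector-valued functions. -/

section RiemannSums

variable {E : Type*} [NormedAddCommGroup E] [NormedSpace ℝ E]

/-- Riemann sums of a continuous vector-valued function converge as the mesh tends to zero. -/
theorem ContinuousOn.exists_mesh_norm_riemannSum_sub_le [CompleteSpace E] {g : ℝ → E} {a b : ℝ}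
    (hg : ContinuousOn g (Icc a b)) (hab : a ≤ b) {ε : ℝ} (hε : 0 < ε) :
    ∃ δ : ℝ, 0 < δ ∧ ∀ (n : ℕ) (p ξ : ℕ → ℝ), p 0 = a → p n = b →
      (∀ i < n, p i ≤ ξ i ∧ ξ i ≤ p (i + 1) ∧ p (i + 1) - p i ≤ δ) →
      (∀ i < n, ξ i ∈ Icc a b) ∧
      ‖(∑ i ∈ Finset.range n, (p (i + 1) - p i) • g (ξ i)) - ∫ s in a..b, g s‖ ≤ ε := by
  -- The `+ 1` keeps the denominator positive when `a = b`.
  have hη : 0 < ε / (b - a + 1) := div_pos hε (by linarith)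
  set η := ε / (b - a + 1) with hηdef
  obtain ⟨δ, hδ, hunif⟩ := Metric.uniformContinuousOn_iff_le.1
    (isCompact_Icc.uniformContinuousOn_of_continuous hg) η hη
  refine ⟨δ, hδ, fun n p ξ h0 hn hp => ?_⟩
  have hmono (j : ℕ) (hj : j ≤ n) : ∀ i ≤ j, p i ≤ p j := by
    induction j with
    | zero => intro i hi; rw [Nat.le_zero.1 hi]
    | succ k ih =>
      intro i hi
      rcases Nat.le_succ_iff.1 hi with h | rfl
      · have := hp k (by omega)
        exact (ih (by omega) i h).trans (this.1.trans this.2.1)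
      · exact le_rfl
  have hmem (i : ℕ) (hi : i ≤ n) : p i ∈ Icc a b :=
    ⟨h0 ▸ hmono i hi 0 (Nat.zero_le _), hn ▸ hmono n le_rfl i hi⟩
  have hξ (i : ℕ) (hi : i < n) : ξ i ∈ Icc a b :=
    ⟨(hmem i hi.le).1.trans (hp i hi).1, (hp i hi).2.1.trans (hmem (i + 1) hi).2⟩
  have hle (i : ℕ) (hi : i < n) : p i ≤ p (i + 1) := (hp i hi).1.trans (hp i hi).2.1
  have hint (i : ℕ) (hi : i < n) : IntervalIntegrable g volume (p i) (p (i + 1)) :=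
    (hg.mono (by rw [uIcc_of_le (hle i hi)]
                 exact Icc_subset_Icc (hmem i hi.le).1 (hmem (i + 1) hi).2)).intervalIntegrable
  refine ⟨hξ, ?_⟩
  have hsum := intervalIntegral.sum_integral_adjacent_intervals hint
  rw [h0, hn] at hsum
  rw [← hsum, ← Finset.sum_sub_distrib]
  have hterm (i : ℕ) (hi : i ∈ Finset.range n) :
      ‖(p (i + 1) - p i) • g (ξ i) - ∫ s in (p i)..(p (i + 1)), g s‖ ≤ η * (p (i + 1) - p i) := by
    have hi := Finset.mem_range.1 hi
    rw [← intervalIntegral.integral_const, ← intervalIntegral.integral_sub (by simp) (hint i hi)]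
    refine (intervalIntegral.norm_integral_le_of_norm_le_const (C := η) fun s hs => ?_).trans_eq
      (by rw [abs_of_nonneg (sub_nonneg.2 (hle i hi))])
    rw [uIoc_of_le (hle i hi)] at hs
    rw [← dist_eq_norm]
    refine hunif _ (hξ i hi) _ ⟨(hmem i hi.le).1.trans hs.1.le, hs.2.trans (hmem (i + 1) hi).2⟩ ?_
    rw [Real.dist_eq, abs_le]
    have := hp i hi
    constructor <;> linarith [hs.1, hs.2]
  calc _ ≤ ∑ i ∈ Finset.range n, η * (p (i + 1) - p i) := norm_sum_le_of_le _ hterm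
    _ = η * (b - a) := by rw [← Finset.mul_sum, Finset.sum_range_sub, h0, hn]
    _ ≤ ε := by
      rw [hηdef, div_mul_eq_mul_div, div_le_iff₀ (by linarith)]
      nlinarith

end RiemannSums

/-! ### Pathwise integrals versus Bochner integrals in `L²(P)`. -/

section L2Integral

variable {Ω : Type*} [MeasurableSpace Ω] {P : Measure Ω} [IsProbabilityMeasure P]

lemma integral_norm_le_norm_of_ae_eq {g : Ω → ℝ} {Φ : Lp ℝ 2 P} (h : Φ =ᵐ[P] g) :
    ∫ ω, ‖g ω‖ ∂P ≤ ‖Φ‖ := by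
  have h1 : ∫ ω, ‖Φ ω‖ ∂P = ∫ ω, ‖g ω‖ ∂P := integral_congr_ae (h.fun_comp norm)
  rw [← h1, Lp.norm_def,
    integral_norm_eq_lintegral_enorm (Lp.aestronglyMeasurable Φ), ← eLpNorm_one_eq_lintegral_enorm]
  exact ENNReal.toReal_mono (Lp.memLp Φ).eLpNorm_ne_top
    (eLpNorm_le_eLpNorm_of_exponent_le one_le_two (Lp.aestronglyMeasurable Φ))

variable {S : Type*} [MeasurableSpace S] {μ : Measure S} [SFinite μ]

/-- The pathwise integral of a jointly measurable process is a version of its `L²`-valued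
Bochner integral. -/
theorem ae_integrable_and_coeFn_integral_Lp {f : S → Ω → ℝ}
    (hf : StronglyMeasurable (Function.uncurry f)) {Φ : S → Lp ℝ 2 P} (hΦ : Integrable Φ μ)
    (hfΦ : ∀ᵐ s ∂μ, Φ s =ᵐ[P] f s) :
    (∀ᵐ ω ∂P, Integrable (fun s => f s ω) μ) ∧
      (fun ω => (∫ s, Φ s ∂μ : Lp ℝ 2 P) ω) =ᵐ[P] fun ω => ∫ s, f s ω ∂μ := by
  have hint (Ψ : Lp ℝ 2 P) : Integrable Ψ P := (Lp.memLp Ψ).integrable one_le_two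
  -- For a probability measure the `L¹` norm is at most the `L²` norm, so Bochner integrability of
  -- `Φ` gives integrability on the product.
  have hprod : Integrable (Function.uncurry f) (μ.prod P) := by
    rw [integrable_prod_iff hf.aestronglyMeasurable]
    constructor
    · filter_upwards [hfΦ] with s hs
      exact (hint (Φ s)).congr hs
    · refine hΦ.norm.mono' hf.norm.aestronglyMeasurable.integral_prod_right' ?_
      filter_upwards [hfΦ] with s hs
      rw [Real.norm_of_nonneg (integral_nonneg fun _ => norm_nonneg _)]
      exact integral_norm_le_norm_of_ae_eq hs
  refine ⟨hprod.prod_left_ae, ?_⟩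
  -- Both sides are compared through their integrals over each event `A`: pairing with the indicator
  -- of `A` commutes with the Bochner integral, and Fubini treats the pathwise one.
  refine Integrable.ae_eq_of_forall_setIntegral_eq _ _ (hint _) hprod.integral_prod_right
    fun A hA _ => ?_
  have hA' : P A ≠ ∞ := measure_ne_top _ _
  have h1 := (innerSL ℝ (indicatorConstLp 2 hA hA' (1 : ℝ))).integral_comp_comm hΦ
  simp only [innerSL_apply_apply, L2.inner_indicatorConstLp_one] at h1
  rw [← h1]
  have h2 : Integrable (Function.uncurry f) (μ.prod (P.restrict A)) := by
    have := hprod.integrableOn (s := univ ×ˢ A)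
    rwa [IntegrableOn, ← Measure.prod_restrict, Measure.restrict_univ] at this
  rw [← integral_integral_swap h2]
  refine integral_congr_ae ?_
  filter_upwards [hfΦ] with s hs
  exact integral_congr_ae (ae_restrict_of_ae hs)

lemma memLp_setIntegral {f : S → Ω → ℝ}
    (hf : StronglyMeasurable (Function.uncurry f)) {Φ : S → Lp ℝ 2 P} (hΦ : Integrable Φ μ)
    (hfΦ : ∀ᵐ s ∂μ, Φ s =ᵐ[P] f s) : MemLp (fun ω => ∫ s, f s ω ∂μ) 2 P :=
  (memLp_congr_ae (ae_integrable_and_coeFn_integral_Lp hf hΦ hfΦ).2).1 (Lp.memLp _)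

omit [IsProbabilityMeasure P] in
lemma eLpNorm_eq_ofReal_norm_of_ae_eq {g : Ω → ℝ} {Φ : Lp ℝ 2 P} (h : Φ =ᵐ[P] g) :
    eLpNorm g 2 P = ENNReal.ofReal ‖Φ‖ := by
  rw [← eLpNorm_congr_ae h, ofReal_norm, Lp.enorm_def]

theorem isL2RiemannIntegral_of_continuousOn {f : ℝ → Ω → ℝ}
    (hf : StronglyMeasurable (Function.uncurry f)) {Φ : ℝ → Lp ℝ 2 P} {a b : ℝ} (hab : a ≤ b)
    (hΦ : ContinuousOn Φ (Icc a b)) (hfΦ : ∀ s ∈ Icc a b, Φ s =ᵐ[P] f s) :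
    IsL2RiemannIntegral P f a b (fun ω => ∫ s in Ioc a b, f s ω) := by
  have hi : IntegrableOn Φ (Ioc a b) :=
    (hΦ.integrableOn_compact isCompact_Icc).mono_set Ioc_subset_Icc_self
  have hae : ∀ᵐ s ∂volume.restrict (Ioc a b), Φ s =ᵐ[P] f s := by
    filter_upwards [ae_restrict_mem measurableSet_Ioc] with s hs
    exact hfΦ s (Ioc_subset_Icc_self hs)
  refine ⟨memLp_setIntegral hf hi hae, fun ε hε => ?_⟩
  obtain ⟨δ, hδ, h⟩ := hΦ.exists_mesh_norm_riemannSum_sub_le hab hε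
  refine ⟨δ, hδ, fun n p ξ h0 hn hp => ?_⟩
  obtain ⟨hξ, hle⟩ := h n p ξ h0 hn hp
  refine (eLpNorm_eq_ofReal_norm_of_ae_eq ?_).trans_le (ENNReal.ofReal_le_ofReal hle)
  rw [intervalIntegral.integral_of_le hab]
  have hall : ∀ᵐ ω ∂P, ∀ i ∈ Finset.range n,
      ((p (i + 1) - p i) • Φ (ξ i) : Lp ℝ 2 P) ω = (p (i + 1) - p i) * f (ξ i) ω := by
    rw [eventually_all_finset]
    intro i hi
    filter_upwards [Lp.coeFn_smul (p (i + 1) - p i) (Φ (ξ i)),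
      hfΦ _ (hξ i (Finset.mem_range.1 hi))] with ω h1 h2
    rw [h1, Pi.smul_apply, h2, smul_eq_mul]
  filter_upwards [Lp.coeFn_sub (∑ i ∈ Finset.range n, (p (i + 1) - p i) • Φ (ξ i))
    (∫ s in Ioc a b, Φ s), (ae_integrable_and_coeFn_integral_Lp hf hi hae).2, hall,
    Lp.coeFn_finsetSum (Finset.range n) (fun i => (p (i + 1) - p i) • Φ (ξ i))] with ω h1 h2 h3 h4
  rw [h1, Pi.sub_apply, h2, h4, Finset.sum_apply, Finset.sum_congr rfl h3]

lemma tendsto_eLpNorm_setIntegral_sub {f : ℝ → Ω → ℝ}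
    (hf : StronglyMeasurable (Function.uncurry f)) {Φ : ℝ → Lp ℝ 2 P} {A : Set ℝ} {B : ℝ → Set ℝ}
    (hA : MeasurableSet A) (hΦ : IntegrableOn Φ A) (hfΦ : ∀ s ∈ A, Φ s =ᵐ[P] f s) {l : Filter ℝ}
    (hBA : ∀ᶠ r in l, B r ⊆ A)
    (hlim : Tendsto (fun r => ∫ s in B r, Φ s) l (𝓝 (∫ s in A, Φ s))) :
    Tendsto (fun r => eLpNorm (fun ω => (∫ s in B r, f s ω) - ∫ s in A, f s ω) 2 P) l (𝓝 0) := by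
  have h0 : Tendsto (fun r => ENNReal.ofReal ‖(∫ s in B r, Φ s) - ∫ s in A, Φ s‖) l (𝓝 0) := by
    simpa using ENNReal.tendsto_ofReal (tendsto_iff_norm_sub_tendsto_zero.1 hlim)
  refine h0.congr' ?_
  filter_upwards [hBA] with r hr
  have hae : ∀ᵐ s ∂volume.restrict A, Φ s =ᵐ[P] f s := by
    filter_upwards [ae_restrict_mem hA] with s hs using hfΦ s hs
  symm
  refine eLpNorm_eq_ofReal_norm_of_ae_eq ?_
  filter_upwards [Lp.coeFn_sub (∫ s in B r, Φ s) (∫ s in A, Φ s),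
    (ae_integrable_and_coeFn_integral_Lp hf hΦ hae).2,
    (ae_integrable_and_coeFn_integral_Lp hf (hΦ.mono_set hr) (ae_restrict_of_ae_restrict_of_subset
      hr hae)).2] with ω h1 h2 h3
  rw [h1, Pi.sub_apply, h2, h3]

theorem isL2ImproperRiemannIntegral_left {f : ℝ → Ω → ℝ}
    (hf : StronglyMeasurable (Function.uncurry f)) {Φ : ℝ → Lp ℝ 2 P} {t : ℝ} (ht : 0 < t)
    (hΦ : ContinuousOn Φ (Ioi 0)) (hi : IntegrableOn Φ (Ioc 0 t))
    (hfΦ : ∀ s ∈ Ioi (0 : ℝ), Φ s =ᵐ[P] f s) :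
    IsL2ImproperRiemannIntegral P f (fun r => r) (fun _ => t) (𝓝[>] 0)
      (fun ω => ∫ s in Ioc 0 t, f s ω) := by
  refine ⟨memLp_setIntegral hf hi ?_, fun r ω => ∫ s in Ioc r t, f s ω, ?_, ?_⟩
  · filter_upwards [ae_restrict_mem measurableSet_Ioc] with s hs using hfΦ s hs.1
  · filter_upwards [Ioc_mem_nhdsGT ht] with r hr
    exact ⟨hr.2, isL2RiemannIntegral_of_continuousOn hf hr.2
      (hΦ.mono fun s hs => hr.1.trans_le hs.1) fun s hs => hfΦ s (hr.1.trans_le hs.1)⟩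
  · refine tendsto_eLpNorm_setIntegral_sub hf measurableSet_Ioc hi (fun s hs => hfΦ s hs.1) ?_ ?_
    · filter_upwards [self_mem_nhdsWithin] with r hr
      exact Ioc_subset_Ioc_left (le_of_lt hr)
    · have h1 : ContinuousOn (fun r => ∫ s in r..t, Φ s) (uIcc 0 t) :=
        intervalIntegral.continuousOn_primitive_interval_left
          (by rwa [uIcc_of_le ht.le, integrableOn_Icc_iff_integrableOn_Ioc])
      have h2 := (h1 0 left_mem_uIcc).tendsto
      rw [uIcc_of_le ht.le] at h2
      have h3 := h2.mono_left (nhdsWithin_le_of_mem (t := Ioi 0) (Icc_mem_nhdsGT ht))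
      rw [intervalIntegral.integral_of_le ht.le] at h3
      refine h3.congr' ?_
      filter_upwards [Ioc_mem_nhdsGT ht] with r hr
      exact intervalIntegral.integral_of_le hr.2

theorem isL2ImproperRiemannIntegral_right {f : ℝ → Ω → ℝ}
    (hf : StronglyMeasurable (Function.uncurry f)) {Φ : ℝ → Lp ℝ 2 P} {t : ℝ} (ht : 0 < t)
    (hΦ : ContinuousOn Φ (Ioi 0)) (hi : IntegrableOn Φ (Ioi t))
    (hfΦ : ∀ s ∈ Ioi (0 : ℝ), Φ s =ᵐ[P] f s) :
    IsL2ImproperRiemannIntegral P f (fun _ => t) (fun r => r) atTop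
      (fun ω => ∫ s in Ioi t, f s ω) := by
  refine ⟨memLp_setIntegral hf hi ?_, fun r ω => ∫ s in Ioc t r, f s ω, ?_, ?_⟩
  · filter_upwards [ae_restrict_mem measurableSet_Ioi] with s hs using hfΦ s (ht.trans hs)
  · filter_upwards [eventually_ge_atTop t] with r hr
    exact ⟨hr, isL2RiemannIntegral_of_continuousOn hf hr
      (hΦ.mono fun s hs => ht.trans_le hs.1) fun s hs => hfΦ s (ht.trans_le hs.1)⟩
  · refine tendsto_eLpNorm_setIntegral_sub hf measurableSet_Ioi hi
      (fun s hs => hfΦ s (ht.trans hs)) (Eventually.of_forall fun r => Ioc_subset_Ioi_self) ?_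
    refine (intervalIntegral_tendsto_integral_Ioi t hi tendsto_id).congr' ?_
    filter_upwards [eventually_ge_atTop t] with r hr
    exact intervalIntegral.integral_of_le hr

end L2Integral

/-! ### The Lamperti transform and the substitution `s = t e^{σa}`. -/

section Lamperti

variable {E : Type*} [NormedAddCommGroup E] [NormedSpace ℝ E]

/-- The Lamperti transform `u ↦ e^{-βu} x(e^u)`. -/
def lamperti (β : ℝ) (x : ℝ≥0 → E) (u : ℝ) : E :=
  Real.exp (-(β * u)) • x (Real.exp u).toNNReal

lemma continuous_lamperti {β : ℝ} {x : ℝ≥0 → E} (hx : Continuous x) :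
    Continuous (lamperti β x) := by
  unfold lamperti
  exact Continuous.smul (by fun_prop)
    (hx.comp (continuous_real_toNNReal.comp Real.continuous_exp))

lemma rpow_smul_lamperti_log (β : ℝ) (x : ℝ≥0 → E) {s : ℝ} (hs : 0 < s) :
    s ^ β • lamperti β x (Real.log s) = x s.toNNReal := by
  rw [lamperti, Real.exp_log hs, Real.rpow_def_of_pos hs, smul_smul, ← Real.exp_add]
  rw [show Real.log s * β + -(β * Real.log s) = 0 by ring, Real.exp_zero, one_smul]

/-- In the exponent, `-1` is absorbed by the Jacobian and `-β` by the Lamperti factor; what remains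
is `t^{-σν} e^{-νa}` because `σ² = 1`. The substitution maps `(0, ∞)` onto `(0, t)` for `σ = -1` and
onto `(t, ∞)` for `σ = 1`. -/
lemma abs_deriv_smul_integrand_eq {ν σ β t a : ℝ} (hσ : |σ| = 1) (ht : 0 < t) (x : ℝ≥0 → E) :
    |t * (σ * Real.exp (σ * a))| • (t * Real.exp (σ * a)) ^ (-(σ * ν) - β - 1) •
      x (t * Real.exp (σ * a)).toNNReal =
    t ^ (-(σ * ν)) • Real.exp (-(ν * a)) • lamperti β x (Real.log t + σ * a) := by
  have hσσ : σ * σ = 1 := by rw [← abs_mul_abs_self, hσ, one_mul]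
  have hs : 0 < t * Real.exp (σ * a) := by positivity
  have hlog : Real.log (t * Real.exp (σ * a)) = Real.log t + σ * a := by
    rw [Real.log_mul ht.ne' (Real.exp_pos _).ne', Real.log_exp]
  rw [← rpow_smul_lamperti_log β x hs, hlog, abs_mul, abs_mul, hσ, one_mul, Real.abs_exp,
    abs_of_pos ht, smul_smul, smul_smul, smul_smul]
  congr 1
  rw [Real.rpow_def_of_pos hs, Real.rpow_def_of_pos hs, Real.rpow_def_of_pos ht, hlog,
    show t * Real.exp (σ * a) = Real.exp (Real.log t + σ * a) by
      rw [Real.exp_add, Real.exp_log ht], ← Real.exp_add, ← Real.exp_add, ← Real.exp_add]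
  congr 1
  linear_combination (-(ν * a)) * hσσ

lemma hasDerivWithinAt_mul_exp (t σ a : ℝ) (A : Set ℝ) :
    HasDerivWithinAt (fun a => t * Real.exp (σ * a)) (t * (σ * Real.exp (σ * a))) A a := by
  have := (((hasDerivAt_id a).const_mul σ).exp.const_mul t).hasDerivWithinAt (s := A)
  simpa [mul_comm σ] using this

lemma injOn_mul_exp {t σ : ℝ} (hσ : |σ| = 1) (ht : 0 < t) (A : Set ℝ) :
    InjOn (fun a => t * Real.exp (σ * a)) A := by
  intro a _ b _ h
  have hσ0 : σ ≠ 0 := by rintro rfl; simp at hσ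
  exact mul_left_cancel₀ hσ0 (Real.exp_injective (mul_left_cancel₀ ht.ne' h))

lemma setIntegral_image_mul_exp {ν σ β t : ℝ} (hσ : |σ| = 1) (ht : 0 < t) (x : ℝ≥0 → E) :
    ∫ s in (fun a => t * Real.exp (σ * a)) '' Ioi 0, s ^ (-(σ * ν) - β - 1) • x s.toNNReal =
      t ^ (-(σ * ν)) • expAvg ν σ (lamperti β x) (Real.log t) := by
  rw [integral_image_eq_integral_abs_deriv_smul measurableSet_Ioi
    (fun a _ => hasDerivWithinAt_mul_exp t σ a _) (injOn_mul_exp hσ ht _)]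
  simp only [abs_deriv_smul_integrand_eq hσ ht]
  rw [integral_smul, expAvg]

lemma integrableOn_image_mul_exp_iff {ν σ β t : ℝ} (hσ : |σ| = 1) (ht : 0 < t) (x : ℝ≥0 → E) :
    IntegrableOn (fun s => s ^ (-(σ * ν) - β - 1) • x s.toNNReal)
      ((fun a => t * Real.exp (σ * a)) '' Ioi 0) ↔
    IntegrableOn (fun a => Real.exp (-(ν * a)) • lamperti β x (Real.log t + σ * a)) (Ioi 0) := by
  rw [integrableOn_image_iff_integrableOn_abs_deriv_smul measurableSet_Ioi
    (fun a _ => hasDerivWithinAt_mul_exp t σ a _) (injOn_mul_exp hσ ht _)]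
  simp only [abs_deriv_smul_integrand_eq hσ ht]
  exact integrable_smul_iff (Real.rpow_pos_of_pos ht _).ne' _

lemma image_mul_exp_one {t : ℝ} (ht : 0 < t) :
    (fun a => t * Real.exp (1 * a)) '' Ioi 0 = Ioi t := by
  ext s
  simp only [mem_image, mem_Ioi, one_mul]
  constructor
  · rintro ⟨a, ha, rfl⟩
    exact lt_mul_of_one_lt_right ht (Real.one_lt_exp_iff.2 ha)
  · intro hs
    refine ⟨Real.log (s / t), Real.log_pos ((one_lt_div ht).2 hs), ?_⟩
    rw [Real.exp_log (div_pos (ht.trans hs) ht), mul_div_cancel₀ _ ht.ne']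

lemma image_mul_exp_neg_one {t : ℝ} (ht : 0 < t) :
    (fun a => t * Real.exp (-1 * a)) '' Ioi 0 = Ioo 0 t := by
  ext s
  simp only [mem_image, mem_Ioi, mem_Ioo, neg_mul, one_mul]
  constructor
  · rintro ⟨a, ha, rfl⟩
    exact ⟨by positivity, mul_lt_of_lt_one_right ht (Real.exp_lt_one_iff.2 (neg_lt_zero.2 ha))⟩
  · rintro ⟨hs, hst⟩
    refine ⟨Real.log (t / s), Real.log_pos ((one_lt_div hs).2 hst), ?_⟩
    rw [← Real.log_inv, inv_div, Real.exp_log (div_pos hs ht), mul_div_cancel₀ _ ht.ne']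

lemma setIntegral_Ioc_rpow_smul {ν β t : ℝ} (ht : 0 < t) (x : ℝ≥0 → E) :
    ∫ s in Ioc 0 t, s ^ (ν - β - 1) • x s.toNNReal =
      t ^ ν • expAvg ν (-1) (lamperti β x) (Real.log t) := by
  have := setIntegral_image_mul_exp (ν := ν) (β := β) (σ := -1) (by simp) ht x
  rw [image_mul_exp_neg_one ht] at this
  simpa [integral_Ioc_eq_integral_Ioo] using this

lemma integrableOn_Ioc_rpow_smul_iff {ν β t : ℝ} (ht : 0 < t) (x : ℝ≥0 → E) :
    IntegrableOn (fun s => s ^ (ν - β - 1) • x s.toNNReal) (Ioc 0 t) ↔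
    IntegrableOn (fun a => Real.exp (-(ν * a)) • lamperti β x (Real.log t + -1 * a)) (Ioi 0) := by
  rw [← integrableOn_image_mul_exp_iff (by simp) ht x, image_mul_exp_neg_one ht,
    integrableOn_Ioc_iff_integrableOn_Ioo]
  simp

lemma setIntegral_Ioi_rpow_smul {ν β t : ℝ} (ht : 0 < t) (x : ℝ≥0 → E) :
    ∫ s in Ioi t, s ^ (-ν - β - 1) • x s.toNNReal =
      t ^ (-ν) • expAvg ν 1 (lamperti β x) (Real.log t) := by
  have := setIntegral_image_mul_exp (ν := ν) (β := β) (σ := 1) (by simp) ht x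
  rw [image_mul_exp_one ht] at this
  simpa using this

lemma integrableOn_Ioi_rpow_smul_iff {ν β t : ℝ} (ht : 0 < t) (x : ℝ≥0 → E) :
    IntegrableOn (fun s => s ^ (-ν - β - 1) • x s.toNNReal) (Ioi t) ↔
    IntegrableOn (fun a => Real.exp (-(ν * a)) • lamperti β x (Real.log t + 1 * a)) (Ioi 0) := by
  rw [← integrableOn_image_mul_exp_iff (by simp) ht x, image_mul_exp_one ht]
  simp

end Lamperti

/-! ### The transformation as a measurable bijection of the path space. -/

section PathTransform

/-- The all-pass filter of parameter `ν` and direction `σ`, conjugated by the Lamperti transform. -/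
def pathAllPass (ν σ β : ℝ) (ω : PathSpace) (t : ℝ≥0) : ℝ :=
  ω t - 2 * ν * ((t : ℝ) ^ β * expAvg ν σ (lamperti β ω) (Real.log t))

lemma fwdIntegrand_eq (α β s : ℝ) (ω : PathSpace) :
    fwdIntegrand α β s ω = s ^ (α + 1 / 2 - β - 1) • ω s.toNNReal := by
  rw [fwdIntegrand, smul_eq_mul, show α - β - 1 / 2 = α + 1 / 2 - β - 1 by ring]

lemma invIntegrand_eq (α β s : ℝ) (ω : PathSpace) :
    invIntegrand α β s ω = s ^ (-(α + 1 / 2) - β - 1) • ω s.toNNReal := by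
  rw [invIntegrand, smul_eq_mul, mul_comm,
    show -β - α - 3 / 2 = -(α + 1 / 2) - β - 1 by ring]

lemma fwdTransform_eq_pathAllPass {α β : ℝ} (hβ : β ≠ 0) (ω : PathSpace) (t : ℝ≥0) :
    fwdTransform α β ω t = pathAllPass (α + 1 / 2) (-1) β ω t := by
  rcases eq_zero_or_pos t with rfl | ht
  -- At `t = 0` the integral is over an empty set, which matters when `β - α - 1/2 = 0`, since `0 ^
  -- 0 = 1`. On the other side `0 ^ β = 0`.
  · simp [fwdTransform, pathAllPass, Real.zero_rpow hβ]
  · have ht' : 0 < (t : ℝ) := ht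
    simp only [fwdTransform, pathAllPass, fwdIntegrand_eq]
    rw [setIntegral_Ioc_rpow_smul ht', smul_eq_mul,
      show (t : ℝ) ^ β = (t : ℝ) ^ (β - α - 1 / 2) * (t : ℝ) ^ (α + 1 / 2) by
        rw [← Real.rpow_add ht']; congr 1; ring]
    ring

/-- At `t = 0` nothing is known about the integral over `(0, ∞)`; only the factor `0 ^ (α + β + 1/2)
= 0` removes it, hence `hαβ`. -/
lemma invTransform_eq_pathAllPass {α β : ℝ} (hβ : β ≠ 0) (hαβ : α + β + 1 / 2 ≠ 0)
    (ω : PathSpace) (t : ℝ≥0) :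
    invTransform α β ω t = pathAllPass (α + 1 / 2) 1 β ω t := by
  rcases eq_zero_or_pos t with rfl | ht
  · rw [invTransform, pathAllPass, NNReal.coe_zero, Real.zero_rpow hβ, Real.zero_rpow hαβ]
    ring
  · have ht' : 0 < (t : ℝ) := ht
    simp only [invTransform, pathAllPass, invIntegrand_eq]
    rw [setIntegral_Ioi_rpow_smul ht', smul_eq_mul,
      show (t : ℝ) ^ β = (t : ℝ) ^ (α + β + 1 / 2) * (t : ℝ) ^ (-(α + 1 / 2)) by
        rw [← Real.rpow_add ht']; congr 1; ring]
    ring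

lemma lamperti_pathAllPass (ν σ β : ℝ) (ω : PathSpace) :
    lamperti β (pathAllPass ν σ β ω) = allPass ν σ (lamperti β ω) := by
  ext u
  have h : Real.exp (-(β * u)) * Real.exp (β * u) = 1 := by rw [← Real.exp_add]; simp
  simp only [lamperti, allPass, pathAllPass, smul_eq_mul, Real.coe_toNNReal _ (Real.exp_pos u).le,
    Real.log_exp, ← Real.exp_mul]
  rw [mul_comm u β]
  linear_combination (-(2 * ν * expAvg ν σ (lamperti β ω) u)) * h

/-- Paths starting at `0` whose Lamperti transform is integrable against `e^{-δ|v|}`. -/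
def temperedPaths (β δ : ℝ) : Set PathSpace :=
  {ω | ω 0 = 0 ∧ ExpIntegrable δ (lamperti β ω)}

/-- Only `t = 0` is delicate. There the growth bound on the average gives `t^β e^{δ|log t|} =
t^{β-δ}` up to a constant, which tends to `0` because `δ < β`. -/
lemma continuous_pathAllPass {ν σ β δ : ℝ} (hσ : |σ| = 1) (hδ : 0 ≤ δ) (hδν : δ ≤ ν) (hδβ : δ < β)
    {ω : PathSpace} (hω : ω ∈ temperedPaths β δ) : Continuous (pathAllPass ν σ β ω) := by
  have hc := hω.2.continuous_expAvg hσ hδ hδν (continuous_lamperti ω.continuous)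
  refine ω.continuous.sub (continuous_const.mul (continuous_iff_continuousAt.2 fun t => ?_))
  rcases eq_zero_or_pos t with rfl | ht
  · have hβ : β ≠ 0 := (hδ.trans_lt hδβ).ne'
    set C := ∫ v, ‖Real.exp (-(δ * |v|)) • lamperti β ω v‖
    have hlim : Tendsto (fun t : ℝ≥0 => (t : ℝ) ^ (β - δ) * C) (𝓝 0) (𝓝 0) := by
      have h1 : Continuous fun t : ℝ≥0 => (t : ℝ) ^ (β - δ) * C :=
        (NNReal.continuous_coe.rpow_const fun _ => Or.inr (sub_pos.2 hδβ).le).mul continuous_const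
      simpa [Real.zero_rpow (sub_pos.2 hδβ).ne'] using h1.tendsto 0
    simp only [ContinuousAt, NNReal.coe_zero, Real.zero_rpow hβ, zero_mul]
    refine squeeze_zero_norm' ?_ hlim
    filter_upwards [Iio_mem_nhds (zero_lt_one (α := ℝ≥0))] with t ht1
    rcases eq_zero_or_pos t with rfl | ht
    · simp [Real.zero_rpow hβ, Real.zero_rpow (sub_pos.2 hδβ).ne']
    · have ht' : 0 < (t : ℝ) := ht
      have hlog : Real.log t ≤ 0 := Real.log_nonpos ht'.le (le_of_lt (by exact_mod_cast ht1))
      rw [norm_mul, Real.norm_of_nonneg (Real.rpow_nonneg ht'.le _)]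
      calc (t : ℝ) ^ β * ‖expAvg ν σ (lamperti β ω) (Real.log t)‖
          ≤ (t : ℝ) ^ β * (Real.exp (δ * |Real.log t|) * C) :=
            mul_le_mul_of_nonneg_left (hω.2.norm_expAvg_le hσ hδ hδν _) (by positivity)
        _ = (t : ℝ) ^ (β - δ) * C := by
            rw [← mul_assoc, Real.rpow_def_of_pos ht', Real.rpow_def_of_pos ht', ← Real.exp_add,
              abs_of_nonpos hlog]
            ring_nf
  · have ht' : (t : ℝ) ≠ 0 := (NNReal.coe_pos.2 ht).ne'
    have h1 : ContinuousAt (fun t : ℝ≥0 => (t : ℝ) ^ β) t :=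
      NNReal.continuous_coe.continuousAt.rpow_const (Or.inl ht')
    have h2 : ContinuousAt (fun t : ℝ≥0 => Real.log t) t :=
      NNReal.continuous_coe.continuousAt.log ht'
    exact h1.mul (ContinuousAt.comp (f := fun t : ℝ≥0 => Real.log t) hc.continuousAt h2)

open Classical in
/-- The all-pass filter as a map of the path space, extended by the identity off the set of
tempered paths. -/
def allPassPath (ν σ β δ : ℝ) (ω : PathSpace) : PathSpace :=
  -- The continuity clause lets the definition make sense for all parameters; in the range of
  -- `continuous_pathAllPass` it follows from temperedness.
  if h : ω ∈ temperedPaths β δ ∧ Continuous (pathAllPass ν σ β ω) then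
    ⟨pathAllPass ν σ β ω, h.2⟩ else ω

variable {ν σ β δ : ℝ}

lemma coe_allPassPath_of_mem (hσ : |σ| = 1) (hδ : 0 ≤ δ) (hδν : δ ≤ ν) (hδβ : δ < β)
    {ω : PathSpace} (hω : ω ∈ temperedPaths β δ) :
    ⇑(allPassPath ν σ β δ ω) = pathAllPass ν σ β ω := by
  rw [allPassPath, dif_pos ⟨hω, continuous_pathAllPass hσ hδ hδν hδβ hω⟩]
  rfl

lemma allPassPath_of_notMem {ω : PathSpace} (hω : ω ∉ temperedPaths β δ) :
    allPassPath ν σ β δ ω = ω :=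
  dif_neg fun h => hω h.1

lemma pathAllPass_zero (hβ : β ≠ 0) (ω : PathSpace) : pathAllPass ν σ β ω 0 = ω 0 := by
  simp [pathAllPass, Real.zero_rpow hβ]

lemma allPassPath_mem (hσ : |σ| = 1) (hδ : 0 ≤ δ) (hδν : δ < ν) (hδβ : δ < β)
    {ω : PathSpace} (hω : ω ∈ temperedPaths β δ) :
    allPassPath ν σ β δ ω ∈ temperedPaths β δ := by
  refine ⟨?_, ?_⟩
  · rw [coe_allPassPath_of_mem hσ hδ hδν.le hδβ hω, pathAllPass_zero (hδ.trans_lt hδβ).ne', hω.1]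
  · rw [coe_allPassPath_of_mem hσ hδ hδν.le hδβ hω, lamperti_pathAllPass]
    exact hω.2.expIntegrable_allPass hσ hδ hδν (continuous_lamperti ω.continuous)

/-- The Lamperti transform sees all times except `0`. -/
lemma path_ext_of_lamperti {ω ω' : PathSpace} (h0 : ω 0 = ω' 0)
    (h : lamperti β ω = lamperti β ω') : ω = ω' := by
  ext t
  rcases eq_zero_or_pos t with rfl | ht
  · exact h0
  · have ht' : 0 < (t : ℝ) := ht
    have h1 := rpow_smul_lamperti_log β ω ht'
    rw [h, rpow_smul_lamperti_log β ω' ht', Real.toNNReal_coe] at h1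
    exact h1.symm

/-- Inversion holds for every path, not just almost every one: both maps preserve the tempered
paths, where the filters are mutually inverse, and both are the identity elsewhere. -/
theorem allPassPath_neg_allPassPath (hσ : |σ| = 1) (hδ : 0 ≤ δ) (hδν : δ < ν) (hδβ : δ < β)
    (ω : PathSpace) : allPassPath ν (-σ) β δ (allPassPath ν σ β δ ω) = ω := by
  have hσ' : |-σ| = 1 := by rwa [abs_neg]
  by_cases hω : ω ∈ temperedPaths β δ
  · have hmem := allPassPath_mem hσ hδ hδν hδβ hω
    have hmem' := allPassPath_mem hσ' hδ hδν hδβ hmem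
    refine path_ext_of_lamperti (hmem'.1.trans hω.1.symm) (β := β) ?_
    rw [coe_allPassPath_of_mem hσ' hδ hδν.le hδβ hmem, lamperti_pathAllPass,
      coe_allPassPath_of_mem hσ hδ hδν.le hδβ hω, lamperti_pathAllPass,
      hω.2.allPass_neg_allPass hσ hδ hδν (continuous_lamperti ω.continuous)]
  · rw [allPassPath_of_notMem hω, allPassPath_of_notMem hω]

lemma measurable_eval_path (t : ℝ≥0) : Measurable fun ω : PathSpace => ω t :=
  (measurable_pi_apply t).comp (comap_measurable _)

lemma measurable_path_iff {Ω : Type*} [MeasurableSpace Ω] {f : Ω → PathSpace} :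
    Measurable f ↔ ∀ t, Measurable fun x => f x t := by
  rw [measurable_comap_iff, measurable_pi_iff]
  rfl

lemma stronglyMeasurable_uncurry_eval_path :
    StronglyMeasurable (Function.uncurry fun (t : ℝ≥0) (ω : PathSpace) => ω t) :=
  stronglyMeasurable_uncurry_of_continuous_of_stronglyMeasurable (fun ω => ω.continuous)
    fun t => (measurable_eval_path t).stronglyMeasurable

lemma stronglyMeasurable_uncurry_eval_path_comp {c : ℝ → ℝ} {τ : ℝ → ℝ≥0} (hc : Measurable c)
    (hτ : Measurable τ) :
    StronglyMeasurable (Function.uncurry fun (s : ℝ) (ω : PathSpace) => c s • ω (τ s)) := by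
  have h1 : StronglyMeasurable (fun p : ℝ × PathSpace => p.2 (τ p.1)) :=
    stronglyMeasurable_uncurry_eval_path.comp_measurable
      (g := fun p : ℝ × PathSpace => (τ p.1, p.2)) (by fun_prop)
  exact (hc.comp measurable_fst).stronglyMeasurable.smul h1

lemma stronglyMeasurable_uncurry_lamperti (β : ℝ) :
    StronglyMeasurable (Function.uncurry fun (u : ℝ) (ω : PathSpace) => lamperti β ω u) :=
  stronglyMeasurable_uncurry_eval_path_comp (c := fun u => Real.exp (-(β * u)))
    (τ := fun u => (Real.exp u).toNNReal) (by fun_prop) (by fun_prop)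

lemma measurableSet_temperedPaths (β δ : ℝ) : MeasurableSet (temperedPaths β δ) := by
  refine (measurable_eval_path 0 (measurableSet_singleton 0)).inter ?_
  have h : StronglyMeasurable (Function.uncurry fun (ω : PathSpace) (v : ℝ) =>
      Real.exp (-(δ * |v|)) • lamperti β ω v) := by
    refine StronglyMeasurable.smul (f := fun p : PathSpace × ℝ => Real.exp (-(δ * |p.2|)))
      (Measurable.stronglyMeasurable (by fun_prop)) ?_
    exact (stronglyMeasurable_uncurry_lamperti β).comp_measurable measurable_swap
  exact measurableSet_integrable h

lemma stronglyMeasurable_uncurry_lamperti_shift (ν σ β u : ℝ) :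
    StronglyMeasurable (Function.uncurry fun (a : ℝ) (ω : PathSpace) =>
      Real.exp (-(ν * a)) • lamperti β ω (u + σ * a)) := by
  refine StronglyMeasurable.smul (f := fun p : ℝ × PathSpace => Real.exp (-(ν * p.1)))
    (Measurable.stronglyMeasurable (by fun_prop)) ?_
  exact (stronglyMeasurable_uncurry_lamperti β).comp_measurable
    (g := fun p : ℝ × PathSpace => (u + σ * p.1, p.2)) (by fun_prop)

lemma measurable_pathAllPass (ν σ β : ℝ) (t : ℝ≥0) :
    Measurable fun ω : PathSpace => pathAllPass ν σ β ω t := by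
  have h1 : Measurable fun ω : PathSpace => expAvg ν σ (lamperti β ω) (Real.log t) :=
    ((stronglyMeasurable_uncurry_lamperti_shift ν σ β (Real.log t)).integral_prod_left'
      (μ := volume.restrict (Ioi 0))).measurable
  exact (measurable_eval_path t).sub ((h1.const_mul _).const_mul _)

lemma measurable_allPassPath (hσ : |σ| = 1) (hδ : 0 ≤ δ) (hδν : δ ≤ ν) (hδβ : δ < β) :
    Measurable (allPassPath ν σ β δ) := by
  classical
  refine measurable_path_iff.2 fun t => ?_
  have h : (fun ω => allPassPath ν σ β δ ω t) = (temperedPaths β δ).piecewise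
      (fun ω => pathAllPass ν σ β ω t) (fun ω => ω t) := by
    ext ω
    by_cases hω : ω ∈ temperedPaths β δ
    · rw [piecewise_eq_of_mem _ _ _ hω, coe_allPassPath_of_mem hσ hδ hδν hδβ hω]
    · rw [piecewise_eq_of_notMem _ _ _ hω, allPassPath_of_notMem hω]
  rw [h]
  exact (measurable_pathAllPass ν σ β t).piecewise (measurableSet_temperedPaths β δ)
    (measurable_eval_path t)

/-- The all-pass filters as measurable automorphisms of the path space. -/
def allPassEquiv (hσ : |σ| = 1) (hδ : 0 ≤ δ) (hδν : δ < ν) (hδβ : δ < β) :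
    PathSpace ≃ᵐ PathSpace where
  toFun := allPassPath ν σ β δ
  invFun := allPassPath ν (-σ) β δ
  left_inv := allPassPath_neg_allPassPath hσ hδ hδν hδβ
  right_inv ω := by
    simpa using allPassPath_neg_allPassPath (σ := -σ) (by rwa [abs_neg]) hδ hδν hδβ ω
  measurable_toFun := measurable_allPassPath hσ hδ hδν.le hδβ
  measurable_invFun := measurable_allPassPath (by rwa [abs_neg]) hδ hδν.le hδβ

end PathTransform

/-! ### Centered Gaussian elements of `L²(P)`. -/

section CharacteristicFunction

variable {Ω : Type*} [MeasurableSpace Ω] {P : Measure Ω} [IsProbabilityMeasure P]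

lemma norm_cexp_mul_I_sub_le (a b : ℝ) :
    ‖Complex.exp (a * Complex.I) - Complex.exp (b * Complex.I)‖ ≤ ‖a - b‖ := by
  have h : Complex.exp (a * Complex.I) - Complex.exp (b * Complex.I) =
      Complex.exp (b * Complex.I) * (Complex.exp (Complex.I * (a - b : ℝ)) - 1) := by
    rw [mul_sub, ← Complex.exp_add, mul_one]
    congr 2
    push_cast
    ring
  rw [h, norm_mul, Complex.norm_exp_ofReal_mul_I, one_mul]
  exact Real.norm_exp_I_mul_ofReal_sub_one_le

lemma integrable_cexp_mul_I {g : Ω → ℝ} (hg : AEStronglyMeasurable g P) :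
    Integrable (fun ω => Complex.exp (g ω * Complex.I)) P := by
  refine (integrable_const (1 : ℝ)).mono' ?_ (Eventually.of_forall fun ω => ?_)
  · exact Complex.continuous_exp.comp_aestronglyMeasurable
      ((Complex.continuous_ofReal.comp_aestronglyMeasurable hg).mul_const _)
  · rw [Complex.norm_exp_ofReal_mul_I]

/-- Continuity of this functional lets Gaussianity pass to `L²` limits. -/
lemma lipschitzWith_integral_cexp_Lp :
    LipschitzWith 1 fun f : Lp ℝ 2 P => ∫ ω, Complex.exp (f ω * Complex.I) ∂P := by
  refine LipschitzWith.of_dist_le_mul fun f g => ?_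
  rw [dist_eq_norm, dist_eq_norm, NNReal.coe_one, one_mul,
    ← integral_sub (integrable_cexp_mul_I (Lp.aestronglyMeasurable f))
      (integrable_cexp_mul_I (Lp.aestronglyMeasurable g))]
  have hsub := Lp.coeFn_sub f g
  refine (norm_integral_le_of_norm_le (g := fun ω => ‖f ω - g ω‖) ?_
    (Eventually.of_forall fun ω => norm_cexp_mul_I_sub_le _ _)).trans ?_
  · exact ((Lp.memLp f).integrable one_le_two).sub ((Lp.memLp g).integrable one_le_two) |>.norm
  · exact integral_norm_le_norm_of_ae_eq hsub

/-- The elements of `L²(P)` whose characteristic function at `1` is that of a centered Gaussian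
variable of the same norm form a closed set. -/
lemma isClosed_setOf_integral_cexp_eq :
    IsClosed {f : Lp ℝ 2 P | ∫ ω, Complex.exp (f ω * Complex.I) ∂P =
      Complex.exp (-(‖f‖ ^ 2 / 2 : ℝ))} :=
  isClosed_eq lipschitzWith_integral_cexp_Lp.continuous
    (Complex.continuous_exp.comp (Complex.continuous_ofReal.comp (by fun_prop)).neg)

omit [IsProbabilityMeasure P] in
lemma norm_sq_Lp_eq_integral {g : Ω → ℝ} {f : Lp ℝ 2 P} (h : f =ᵐ[P] g) :
    ‖f‖ ^ 2 = ∫ ω, g ω ^ 2 ∂P := by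
  rw [← real_inner_self_eq_norm_sq, L2.inner_def]
  refine integral_congr_ae ?_
  filter_upwards [h] with ω hω
  rw [hω, real_inner_self_eq_norm_sq, Real.norm_eq_abs, sq_abs]

omit [IsProbabilityMeasure P] in
lemma integral_cexp_of_hasGaussianLaw {g : Ω → ℝ} (hg : HasGaussianLaw g P)
    (h0 : ∫ ω, g ω ∂P = 0) {f : Lp ℝ 2 P} (hf : f =ᵐ[P] g) :
    ∫ ω, Complex.exp (f ω * Complex.I) ∂P = Complex.exp (-(‖f‖ ^ 2 / 2 : ℝ)) := by
  have h1 := hg.charFun_map_eq 1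
  rw [charFun_apply_real, integral_map hg.aemeasurable
    (Continuous.aestronglyMeasurable (by fun_prop))] at h1
  have h2 : Var[g; P] = ‖f‖ ^ 2 := by
    rw [variance_of_integral_eq_zero hg.aemeasurable h0, norm_sq_Lp_eq_integral hf]
  simp only [RCLike.inner_apply, conj_trivial, mul_one] at h1
  rw [h0, h2] at h1
  calc ∫ ω, Complex.exp (f ω * Complex.I) ∂P
      = ∫ ω, Complex.exp ((1 : ℝ) * g ω * Complex.I) ∂P := by
        refine integral_congr_ae ?_
        filter_upwards [hf] with ω hω
        rw [hω, Complex.ofReal_one, one_mul]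
    _ = _ := by
        rw [h1]
        congr 1
        push_cast
        ring

end CharacteristicFunction

/-! ### A covariance criterion for preserving the path measure. -/

section PathMeasure

lemma measure_path_ext {μ ν : Measure PathSpace}
    (h : μ.map (fun (ω : PathSpace) (t : ℝ≥0) => ω t) =
      ν.map (fun (ω : PathSpace) (t : ℝ≥0) => ω t)) : μ = ν := by
  have hm : Measurable fun (ω : PathSpace) (t : ℝ≥0) => ω t := comap_measurable _
  ext A hA
  obtain ⟨B, hB, rfl⟩ := hA
  rw [← Measure.map_apply hm hB, h, Measure.map_apply hm hB]

/-- The Gram matrix determines the norm of every linear combination. -/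
lemma norm_sum_smul_eq_of_inner_eq {ι κ H : Type*} [NormedAddCommGroup H] [InnerProductSpace ℝ H]
    {X Z : κ → H} (h : ∀ s t, inner ℝ (Z s) (Z t) = inner ℝ (X s) (X t)) (I : Finset ι)
    (c : ι → ℝ) (τ : ι → κ) : ‖∑ i ∈ I, c i • Z (τ i)‖ = ‖∑ i ∈ I, c i • X (τ i)‖ := by
  refine (sq_eq_sq₀ (norm_nonneg _) (norm_nonneg _)).1 ?_
  rw [← real_inner_self_eq_norm_sq, ← real_inner_self_eq_norm_sq]
  simp only [sum_inner, inner_sum, real_inner_smul_left, real_inner_smul_right, h]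

variable {P : Measure PathSpace} [IsProbabilityMeasure P]

-- A linear functional of finitely many coordinates is represented by an element of `S`, so its
-- characteristic function depends only on an `L²` norm.
omit [IsProbabilityMeasure P] in
lemma integral_cexp_dual_restrict {T : ℝ≥0 → PathSpace → ℝ} {Z : ℝ≥0 → Lp ℝ 2 P}
    (hZ : ∀ t, Z t =ᵐ[P] T t) (I : Finset ℝ≥0) (L : StrongDual ℝ (I → ℝ))
    {S : Submodule ℝ (Lp ℝ 2 P)}
    (hS : ∀ f ∈ S, ∫ ω, Complex.exp (f ω * Complex.I) ∂P = Complex.exp (-(‖f‖ ^ 2 / 2 : ℝ)))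
    (hZS : ∀ t, Z t ∈ S) :
    ∫ ω, Complex.exp (L (I.restrict (T · ω)) * Complex.I) ∂P =
      Complex.exp (-(‖∑ i : I, L (Pi.single i 1) • Z i‖ ^ 2 / 2 : ℝ)) := by
  classical
  rw [← hS (∑ i : I, L (Pi.single i 1) • Z i) (S.sum_mem fun i _ => S.smul_mem _ (hZS i))]
  refine integral_congr_ae ?_
  have hall : ∀ᵐ ω ∂P, ∀ i : I, (L (Pi.single i 1) • Z i : Lp ℝ 2 P) ω =
      L (Pi.single i 1) * T i ω := by
    rw [ae_all_iff]
    intro i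
    filter_upwards [Lp.coeFn_smul (L (Pi.single i 1)) (Z i), hZ i] with ω h1 h2
    rw [h1, Pi.smul_apply, h2, smul_eq_mul]
  filter_upwards [hall, Lp.coeFn_finsetSum Finset.univ
    (fun i : I => L (Pi.single i 1) • Z i)] with ω h1 h2
  rw [h2, Finset.sum_apply, Finset.sum_congr rfl fun i _ => h1 i]
  have h3 := LinearMap.pi_apply_eq_sum_univ (L : (I → ℝ) →ₗ[ℝ] ℝ) (I.restrict (T · ω))
  simp only [ContinuousLinearMap.coe_coe, smul_eq_mul] at h3
  rw [h3]
  congr 3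
  refine Finset.sum_congr rfl fun i _ => ?_
  rw [mul_comm]
  congr 2
  ext j
  simp [Pi.single_apply, eq_comm]

/-- A measurable transformation of the path space which, in `L²(P)`, acts on the coordinate
process by an isometry within a Gaussian space preserves the measure. -/
theorem measurePreserving_of_inner_eq {T : PathSpace → PathSpace} (hT : Measurable T)
    {X Z : ℝ≥0 → Lp ℝ 2 P} (hX : ∀ t, X t =ᵐ[P] fun ω => ω t) (hZ : ∀ t, Z t =ᵐ[P] fun ω => T ω t)
    {S : Submodule ℝ (Lp ℝ 2 P)}
    (hS : ∀ f ∈ S, ∫ ω, Complex.exp (f ω * Complex.I) ∂P = Complex.exp (-(‖f‖ ^ 2 / 2 : ℝ)))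
    (hXS : ∀ t, X t ∈ S) (hZS : ∀ t, Z t ∈ S)
    (hinner : ∀ s t, inner ℝ (Z s) (Z t) = inner ℝ (X s) (X t)) :
    MeasurePreserving T P P := by
  refine ⟨hT, measure_path_ext ?_⟩
  have hm : Measurable fun (ω : PathSpace) (t : ℝ≥0) => ω t := comap_measurable _
  rw [Measure.map_map hm hT]
  refine (map_eq_iff_forall_finset_map_restrict_eq (X := fun t ω => T ω t)
    (Y := fun t (ω : PathSpace) => ω t) (hm.comp hT).aemeasurable hm.aemeasurable).2 fun I => ?_
  have hmI : Measurable fun ω : PathSpace => I.restrict fun t => ω t :=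
    (Finset.measurable_restrict I).comp hm
  have hmI' : Measurable fun ω : PathSpace => I.restrict fun t => T ω t := hmI.comp hT
  have := Measure.isFiniteMeasure_map P fun ω : PathSpace => I.restrict fun t => ω t
  have := Measure.isFiniteMeasure_map P fun ω : PathSpace => I.restrict fun t => T ω t
  refine Measure.ext_of_charFunDual (funext fun L => ?_)
  rw [charFunDual_apply, charFunDual_apply,
    integral_map hmI'.aemeasurable (Continuous.aestronglyMeasurable (by fun_prop)),
    integral_map hmI.aemeasurable (Continuous.aestronglyMeasurable (by fun_prop)),
    integral_cexp_dual_restrict (T := fun t ω => T ω t) hZ I L hS hZS,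
    integral_cexp_dual_restrict (T := fun t ω => ω t) hX I L hS hXS,
    norm_sum_smul_eq_of_inner_eq hinner]

end PathMeasure

/-! ### The coordinate process as a curve in `L²(P)`. -/

namespace IsSelfSimilarGaussianLaw

variable {β : ℝ} {P : Measure PathSpace}

lemma memLp_two (hP : IsSelfSimilarGaussianLaw β P) (t : ℝ≥0) : MemLp (coordProcess t) 2 P :=
  (hP.isGaussianProcess.hasGaussianLaw_eval t).memLp_two

/-- The coordinate process as a curve in `L²(P)`. -/
def coordLp (hP : IsSelfSimilarGaussianLaw β P) (t : ℝ≥0) : Lp ℝ 2 P :=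
  (hP.memLp_two t).toLp (coordProcess t)

lemma coeFn_coordLp (hP : IsSelfSimilarGaussianLaw β P) (t : ℝ≥0) :
    hP.coordLp t =ᵐ[P] fun ω => ω t :=
  (hP.memLp_two t).coeFn_toLp

lemma inner_coordLp (hP : IsSelfSimilarGaussianLaw β P) (s t : ℝ≥0) :
    inner ℝ (hP.coordLp s) (hP.coordLp t) = ∫ ω, coordProcess s ω * coordProcess t ω ∂P := by
  rw [L2.inner_def]
  refine integral_congr_ae ?_
  filter_upwards [hP.coeFn_coordLp s, hP.coeFn_coordLp t] with ω h1 h2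
  rw [h1, h2, RCLike.inner_apply, conj_trivial, mul_comm]
  rfl

lemma inner_coordLp_mul (hP : IsSelfSimilarGaussianLaw β P) {a : ℝ≥0} (ha : 0 < a) (s t : ℝ≥0) :
    inner ℝ (hP.coordLp (a * s)) (hP.coordLp (a * t)) =
      ((a : ℝ) ^ β) ^ 2 * inner ℝ (hP.coordLp s) (hP.coordLp t) := by
  classical
  have h := (hP.selfSimilar a ha {s, t}).comp
    (u := fun x : ({s, t} : Finset ℝ≥0) → ℝ => x ⟨s, by simp⟩ * x ⟨t, by simp⟩) (by fun_prop)
  have h1 := h.integral_eq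
  simp only [Function.comp_def, Finset.restrict] at h1
  rw [hP.inner_coordLp, hP.inner_coordLp, h1, ← integral_const_mul]
  congr 1
  ext ω
  ring

/-- Time `0` is fixed by scaling, so `‖X_0‖² = 2^{2β} ‖X_0‖²` with `2^{2β} > 1`. -/
lemma coordLp_zero (hP : IsSelfSimilarGaussianLaw β P) (hβ : 0 < β) : hP.coordLp 0 = 0 := by
  have h := hP.inner_coordLp_mul (a := 2) (by norm_num) 0 0
  rw [mul_zero] at h
  have h2 : 1 < ((2 : ℝ≥0) : ℝ) ^ β := Real.one_lt_rpow (by norm_num) hβ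
  have h3 : inner ℝ (hP.coordLp 0) (hP.coordLp 0) = 0 := by
    have : (((2 : ℝ≥0) : ℝ) ^ β) ^ 2 - 1 ≠ 0 := by nlinarith
    refine (mul_eq_zero.1 (?_ : ((((2 : ℝ≥0) : ℝ) ^ β) ^ 2 - 1) * _ = 0)).resolve_left this
    linear_combination -h
  exact inner_self_eq_zero.1 h3

/-- The Gaussian space of the coordinate process. -/
def gaussianSpace (hP : IsSelfSimilarGaussianLaw β P) : Submodule ℝ (Lp ℝ 2 P) :=
  (Submodule.span ℝ (range hP.coordLp)).topologicalClosure

lemma isClosed_gaussianSpace (hP : IsSelfSimilarGaussianLaw β P) :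
    IsClosed (hP.gaussianSpace : Set (Lp ℝ 2 P)) :=
  Submodule.isClosed_topologicalClosure _

lemma coordLp_mem_gaussianSpace (hP : IsSelfSimilarGaussianLaw β P) (t : ℝ≥0) :
    hP.coordLp t ∈ hP.gaussianSpace :=
  Submodule.le_topologicalClosure _ (Submodule.subset_span (mem_range_self t))

/-- Finite linear combinations are centered Gaussian, and the identity survives the closure by
`isClosed_setOf_integral_cexp_eq`. -/
lemma integral_cexp_of_mem_gaussianSpace (hP : IsSelfSimilarGaussianLaw β P) (f : Lp ℝ 2 P)
    (hf : f ∈ hP.gaussianSpace) :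
    ∫ ω, Complex.exp (f ω * Complex.I) ∂P = Complex.exp (-(‖f‖ ^ 2 / 2 : ℝ)) := by
  have := hP.isProbabilityMeasure
  refine closure_minimal ?_ (isClosed_setOf_integral_cexp_eq (P := P)) hf
  intro g hg
  obtain ⟨c, rfl⟩ := Finsupp.mem_span_range_iff_exists_finsupp.1 hg
  have hsum : ((c.sum fun t a => a • hP.coordLp t : Lp ℝ 2 P) : PathSpace → ℝ) =ᵐ[P]
      fun ω => ∑ t ∈ c.support, c t • coordProcess t ω := by
    have hall : ∀ᵐ ω ∂P, ∀ t ∈ c.support,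
        (c t • hP.coordLp t : Lp ℝ 2 P) ω = c t • coordProcess t ω := by
      rw [eventually_all_finset]
      intro t _
      filter_upwards [Lp.coeFn_smul (c t) (hP.coordLp t), hP.coeFn_coordLp t] with ω h1 h2
      rw [h1, Pi.smul_apply, h2]
      rfl
    filter_upwards [hall, Lp.coeFn_finsetSum c.support
      (fun t => c t • hP.coordLp t)] with ω h1 h2
    rw [Finsupp.sum, h2, Finset.sum_apply, Finset.sum_congr rfl h1]
  refine integral_cexp_of_hasGaussianLaw
    ((hP.isGaussianProcess.smul c).hasGaussianLaw_fun_sum (I := c.support)) ?_ hsum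
  rw [integral_finsetSum (f := fun t ω => c t • coordProcess t ω) _
    fun t _ => ((hP.memLp_two t).integrable one_le_two).smul (c t)]
  refine Finset.sum_eq_zero fun t _ => ?_
  rw [integral_smul, hP.centered, smul_zero]

/-- A continuous centered Gaussian process is continuous in `L²`. -/
lemma continuous_coordLp (hP : IsSelfSimilarGaussianLaw β P) : Continuous hP.coordLp := by
  have := hP.isProbabilityMeasure
  refine continuous_iff_continuousAt.2 fun t => ?_
  rw [ContinuousAt, tendsto_iff_norm_sub_tendsto_zero]
  -- The characteristic function of the increment encodes its `L²` norm. Path continuity and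
  -- dominated convergence send it to `1`, and taking logarithms sends the norm to `0`.
  have hcf (s : ℝ≥0) : ∫ ω : PathSpace, Complex.exp ((ω s - ω t : ℝ) * Complex.I) ∂P =
      (Real.exp (-(‖hP.coordLp s - hP.coordLp t‖ ^ 2 / 2)) : ℝ) := by
    rw [Complex.ofReal_exp, Complex.ofReal_neg, ← hP.integral_cexp_of_mem_gaussianSpace _
      (Submodule.sub_mem _ (hP.coordLp_mem_gaussianSpace s) (hP.coordLp_mem_gaussianSpace t))]
    refine integral_congr_ae ?_
    filter_upwards [Lp.coeFn_sub (hP.coordLp s) (hP.coordLp t), hP.coeFn_coordLp s,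
      hP.coeFn_coordLp t] with ω h1 h2 h3
    rw [h1, Pi.sub_apply, h2, h3]
  have hlim : Tendsto (fun s : ℝ≥0 =>
      ∫ ω : PathSpace, Complex.exp ((ω s - ω t : ℝ) * Complex.I) ∂P) (𝓝 t) (𝓝 1) := by
    have h1 : (1 : ℂ) = ∫ ω : PathSpace, Complex.exp ((ω t - ω t : ℝ) * Complex.I) ∂P := by simp
    rw [h1]
    refine tendsto_integral_filter_of_dominated_convergence (fun _ => (1 : ℝ))
      (Eventually.of_forall fun s => (integrable_cexp_mul_I ?_).aestronglyMeasurable)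
      (Eventually.of_forall fun s => Eventually.of_forall fun ω => ?_) (integrable_const _)
      (Eventually.of_forall fun ω => ?_)
    · exact ((measurable_eval_path s).sub (measurable_eval_path t)).aestronglyMeasurable
    · rw [Complex.norm_exp_ofReal_mul_I]
    · have hc : Continuous fun s : ℝ≥0 => Complex.exp ((ω s - ω t : ℝ) * Complex.I) := by
        have := ω.continuous
        fun_prop
      exact hc.tendsto t
  simp only [hcf] at hlim
  have hre := (Complex.continuous_re.tendsto _).comp hlim
  simp only [Function.comp_def, Complex.ofReal_re, Complex.one_re] at hre
  have hlog := ((Real.continuousAt_log one_ne_zero).tendsto.comp hre).const_mul (-2)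
  simp only [Function.comp_def, Real.log_exp, Real.log_one, mul_zero] at hlog
  have hsqrt := (Real.continuous_sqrt.tendsto _).comp hlog
  simp only [Function.comp_def, Real.sqrt_zero] at hsqrt
  refine hsqrt.congr fun s => ?_
  rw [show -2 * -(‖hP.coordLp s - hP.coordLp t‖ ^ 2 / 2) = ‖hP.coordLp s - hP.coordLp t‖ ^ 2 by
    ring, Real.sqrt_sq (norm_nonneg _)]

/-- Self-similarity with `a = e^h` becomes invariance under the shift by `h`. -/
lemma inner_lamperti_coordLp (hP : IsSelfSimilarGaussianLaw β P) (u v h : ℝ) :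
    inner ℝ (lamperti β hP.coordLp (u + h)) (lamperti β hP.coordLp (v + h)) =
      inner ℝ (lamperti β hP.coordLp u) (lamperti β hP.coordLp v) := by
  have hmul (w : ℝ) : (Real.exp (w + h)).toNNReal = (Real.exp h).toNNReal *
      (Real.exp w).toNNReal := by
    rw [← Real.toNNReal_mul (Real.exp_pos h).le, ← Real.exp_add, add_comm]
  have hexp : Real.exp (-(β * (u + h))) * (Real.exp (-(β * (v + h))) * (Real.exp h ^ β) ^ 2) =
      Real.exp (-(β * u)) * Real.exp (-(β * v)) := by
    rw [← Real.exp_mul, ← Real.exp_nat_mul, ← Real.exp_add, ← Real.exp_add, ← Real.exp_add]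
    push_cast
    ring_nf
  simp only [lamperti, real_inner_smul_left, real_inner_smul_right, hmul]
  rw [hP.inner_coordLp_mul (Real.toNNReal_pos.2 (Real.exp_pos h)),
    Real.coe_toNNReal _ (Real.exp_pos h).le]
  linear_combination (inner ℝ (hP.coordLp (Real.exp u).toNNReal)
    (hP.coordLp (Real.exp v).toNNReal)) * hexp

lemma continuous_lamperti_coordLp (hP : IsSelfSimilarGaussianLaw β P) :
    Continuous (lamperti β hP.coordLp) :=
  continuous_lamperti hP.continuous_coordLp

lemma expIntegrable_lamperti_coordLp (hP : IsSelfSimilarGaussianLaw β P) {δ : ℝ} (hδ : 0 < δ) :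
    ExpIntegrable δ (lamperti β hP.coordLp) :=
  expIntegrable_of_norm_le hδ hP.continuous_lamperti_coordLp
    fun u => (norm_eq_of_stationary hP.inner_lamperti_coordLp u).le

lemma coeFn_smul_lamperti_coordLp (hP : IsSelfSimilarGaussianLaw β P) (c u : ℝ) :
    (c • lamperti β hP.coordLp u : Lp ℝ 2 P) =ᵐ[P] fun ω => c • lamperti β ω u := by
  rw [lamperti, smul_smul]
  filter_upwards [Lp.coeFn_smul (c * Real.exp (-(β * u))) (hP.coordLp (Real.exp u).toNNReal),
    hP.coeFn_coordLp (Real.exp u).toNNReal] with ω h1 h2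
  rw [h1, Pi.smul_apply, h2, lamperti, smul_smul]

/-- Almost every path is tempered. -/
theorem ae_mem_temperedPaths (hP : IsSelfSimilarGaussianLaw β P) (hβ : 0 < β) {δ : ℝ}
    (hδ : 0 < δ) : ∀ᵐ ω ∂P, ω ∈ temperedPaths β δ := by
  have := hP.isProbabilityMeasure
  have hf : StronglyMeasurable (Function.uncurry fun (v : ℝ) (ω : PathSpace) =>
      Real.exp (-(δ * |v|)) • lamperti β ω v) :=
    StronglyMeasurable.smul (f := fun p : ℝ × PathSpace => Real.exp (-(δ * |p.1|)))
      (Measurable.stronglyMeasurable (by fun_prop)) (stronglyMeasurable_uncurry_lamperti β)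
  -- Stationarity makes the `L²` curve bounded, hence integrable against `e^{-δ|v|}`; almost every
  -- path inherits this integrability.
  have h1 := (ae_integrable_and_coeFn_integral_Lp hf (hP.expIntegrable_lamperti_coordLp hδ)
    (Eventually.of_forall fun v => hP.coeFn_smul_lamperti_coordLp _ v)).1
  have h2 := hP.coeFn_coordLp 0
  rw [hP.coordLp_zero hβ] at h2
  filter_upwards [h1, h2, Lp.coeFn_zero ℝ 2 P] with ω h1 h2 h3
  refine ⟨?_, h1⟩
  rw [← h2, h3]
  rfl

/-- The transformed process as a curve in `L²(P)`. -/
def pathAllPassLp (hP : IsSelfSimilarGaussianLaw β P) (ν σ : ℝ) (t : ℝ≥0) : Lp ℝ 2 P :=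
  hP.coordLp t - (2 * ν * (t : ℝ) ^ β) • expAvg ν σ (lamperti β hP.coordLp) (Real.log t)

lemma coeFn_pathAllPassLp (hP : IsSelfSimilarGaussianLaw β P) {ν σ : ℝ} (hσ : |σ| = 1)
    (hν : 0 < ν) (t : ℝ≥0) :
    hP.pathAllPassLp ν σ t =ᵐ[P] fun ω => pathAllPass ν σ β ω t := by
  have := hP.isProbabilityMeasure
  have h1 := (ae_integrable_and_coeFn_integral_Lp
    (stronglyMeasurable_uncurry_lamperti_shift ν σ β (Real.log t))
    ((hP.expIntegrable_lamperti_coordLp hν).integrableOn hσ hν.le le_rfl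
      hP.continuous_lamperti_coordLp (Real.log t))
    (Eventually.of_forall fun a => hP.coeFn_smul_lamperti_coordLp _ _)).2
  unfold pathAllPassLp
  filter_upwards [Lp.coeFn_sub (hP.coordLp t)
    ((2 * ν * (t : ℝ) ^ β) • expAvg ν σ (lamperti β hP.coordLp) (Real.log t)),
    Lp.coeFn_smul (2 * ν * (t : ℝ) ^ β) (expAvg ν σ (lamperti β hP.coordLp) (Real.log t)),
    hP.coeFn_coordLp t, h1] with ω h2 h3 h4 h5
  rw [h2, Pi.sub_apply, h3, Pi.smul_apply, h4, expAvg, h5, pathAllPass, expAvg, smul_eq_mul,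
    mul_assoc]

lemma pathAllPassLp_mem_gaussianSpace (hP : IsSelfSimilarGaussianLaw β P) (ν σ : ℝ) (t : ℝ≥0) :
    hP.pathAllPassLp ν σ t ∈ hP.gaussianSpace :=
  Submodule.sub_mem _ (hP.coordLp_mem_gaussianSpace t) <| Submodule.smul_mem _ _ <|
    Submodule.setIntegral_mem hP.isClosed_gaussianSpace fun _ => Submodule.smul_mem _ _ <|
      Submodule.smul_mem _ _ (hP.coordLp_mem_gaussianSpace _)

/-- At positive times both curves are `t^β` times a stationary curve at `log t`, filtered or not, so
`inner_allPass_allPass` applies; at time `0` both vanish. -/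
lemma inner_pathAllPassLp (hP : IsSelfSimilarGaussianLaw β P) (hβ : 0 < β) {ν σ : ℝ}
    (hσ : |σ| = 1) (hν : 0 < ν) (s t : ℝ≥0) :
    inner ℝ (hP.pathAllPassLp ν σ s) (hP.pathAllPassLp ν σ t) =
      inner ℝ (hP.coordLp s) (hP.coordLp t) := by
  have hzero : hP.pathAllPassLp ν σ 0 = 0 := by
    simp [pathAllPassLp, hP.coordLp_zero hβ, Real.zero_rpow hβ.ne']
  have hcoord {t : ℝ≥0} (ht : 0 < t) :
      hP.coordLp t = (t : ℝ) ^ β • lamperti β hP.coordLp (Real.log t) := by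
    rw [rpow_smul_lamperti_log β hP.coordLp (NNReal.coe_pos.2 ht), Real.toNNReal_coe]
  have hpos {t : ℝ≥0} (ht : 0 < t) : hP.pathAllPassLp ν σ t =
      (t : ℝ) ^ β • allPass ν σ (lamperti β hP.coordLp) (Real.log t) := by
    rw [pathAllPassLp, hcoord ht, allPass]
    module
  rcases eq_zero_or_pos s with rfl | hs
  · rw [hzero, hP.coordLp_zero hβ, inner_zero_left, inner_zero_left]
  rcases eq_zero_or_pos t with rfl | ht
  · rw [hzero, hP.coordLp_zero hβ, inner_zero_right, inner_zero_right]
  rw [hpos hs, hpos ht, hcoord hs, hcoord ht, real_inner_smul_left, real_inner_smul_right,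
    real_inner_smul_left, real_inner_smul_right, inner_allPass_allPass hσ hν
      hP.continuous_lamperti_coordLp hP.inner_lamperti_coordLp]

theorem measurePreserving_allPassPath (hP : IsSelfSimilarGaussianLaw β P) (hβ : 0 < β)
    {ν σ δ : ℝ} (hσ : |σ| = 1) (hδ : 0 < δ) (hδν : δ < ν) (hδβ : δ < β) :
    MeasurePreserving (allPassPath ν σ β δ) P P := by
  have := hP.isProbabilityMeasure
  have hν : 0 < ν := hδ.trans hδν
  refine measurePreserving_of_inner_eq (measurable_allPassPath hσ hδ.le hδν.le hδβ)
    hP.coeFn_coordLp (Z := hP.pathAllPassLp ν σ) (fun t => ?_)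
    hP.integral_cexp_of_mem_gaussianSpace hP.coordLp_mem_gaussianSpace
    (hP.pathAllPassLp_mem_gaussianSpace ν σ) (hP.inner_pathAllPassLp hβ hσ hν)
  filter_upwards [hP.coeFn_pathAllPassLp hσ hν t, hP.ae_mem_temperedPaths hβ hδ] with ω h1 h2
  rw [h1, coe_allPassPath_of_mem hσ hδ.le hδν.le hδβ h2]

lemma continuousOn_rpow_smul_coordLp (hP : IsSelfSimilarGaussianLaw β P) (c : ℝ) :
    ContinuousOn (fun s : ℝ => s ^ c • hP.coordLp s.toNNReal) (Ioi 0) :=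
  ContinuousOn.smul
    (continuousOn_id.rpow_const fun _ hs => Or.inl (ne_of_gt hs))
    (hP.continuous_coordLp.comp continuous_real_toNNReal).continuousOn

lemma coeFn_rpow_smul_coordLp (hP : IsSelfSimilarGaussianLaw β P) (c s : ℝ) :
    (s ^ c • hP.coordLp s.toNNReal : Lp ℝ 2 P) =ᵐ[P] fun ω => s ^ c • ω s.toNNReal := by
  filter_upwards [Lp.coeFn_smul (s ^ c) (hP.coordLp s.toNNReal),
    hP.coeFn_coordLp s.toNNReal] with ω h1 h2
  rw [h1, Pi.smul_apply, h2]

lemma isL2ImproperRiemannIntegral_fwdIntegrand (hP : IsSelfSimilarGaussianLaw β P) {α : ℝ}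
    (hα : 0 < α + 1 / 2) {t : ℝ} (ht : 0 < t) :
    IsL2ImproperRiemannIntegral P (fwdIntegrand α β) (fun r => r) (fun _ => t) (𝓝[>] 0)
      (fun ω => ∫ s in Ioc 0 t, fwdIntegrand α β s ω) := by
  have := hP.isProbabilityMeasure
  have hf : fwdIntegrand α β = fun s ω => s ^ (α + 1 / 2 - β - 1) • ω s.toNNReal := by
    ext s ω
    exact fwdIntegrand_eq α β s ω
  rw [hf]
  refine isL2ImproperRiemannIntegral_left (stronglyMeasurable_uncurry_eval_path_comp
    (c := fun s => s ^ (α + 1 / 2 - β - 1)) (by fun_prop) (by fun_prop)) ht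
    (hP.continuousOn_rpow_smul_coordLp _) ?_ fun s _ => hP.coeFn_rpow_smul_coordLp _ s
  exact (integrableOn_Ioc_rpow_smul_iff ht hP.coordLp).2
    ((hP.expIntegrable_lamperti_coordLp hα).integrableOn (by simp) hα.le le_rfl
      hP.continuous_lamperti_coordLp _)

lemma isL2ImproperRiemannIntegral_invIntegrand (hP : IsSelfSimilarGaussianLaw β P) {α : ℝ}
    (hα : 0 < α + 1 / 2) {t : ℝ} (ht : 0 < t) :
    IsL2ImproperRiemannIntegral P (invIntegrand α β) (fun _ => t) (fun r => r) atTop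
      (fun ω => ∫ s in Ioi t, invIntegrand α β s ω) := by
  have := hP.isProbabilityMeasure
  have hf : invIntegrand α β = fun s ω => s ^ (-(α + 1 / 2) - β - 1) • ω s.toNNReal := by
    ext s ω
    exact invIntegrand_eq α β s ω
  rw [hf]
  refine isL2ImproperRiemannIntegral_right (stronglyMeasurable_uncurry_eval_path_comp
    (c := fun s => s ^ (-(α + 1 / 2) - β - 1)) (by fun_prop) (by fun_prop)) ht
    (hP.continuousOn_rpow_smul_coordLp _) ?_ fun s _ => hP.coeFn_rpow_smul_coordLp _ s
  exact (integrableOn_Ioi_rpow_smul_iff ht hP.coordLp).2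
    ((hP.expIntegrable_lamperti_coordLp hα).integrableOn (by simp) hα.le le_rfl
      hP.continuous_lamperti_coordLp _)

end IsSelfSimilarGaussianLaw

end

/-! ### The main theorem. -/

theorem theorem1 (α β : ℝ) (hα : -1 / 2 < α) (hβ : 0 < β)
    (P : Measure PathSpace) (hP : IsSelfSimilarGaussianLaw β P) :
    -- the integrals converge absolutely, almost surely
    (∀ᵐ ω ∂P, ∀ t : ℝ≥0, 0 < t →
      IntegrableOn (fun s => fwdIntegrand α β s ω) (Ioc (0 : ℝ) t) ∧
      IntegrableOn (fun s => invIntegrand α β s ω) (Ioi (t : ℝ))) ∧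
    -- they are limits in `L²(P)` of Riemann sums
    (∀ t : ℝ≥0, 0 < t →
      IsL2ImproperRiemannIntegral P (fwdIntegrand α β) (fun r => r) (fun _ => (t : ℝ)) (𝓝[>] 0)
        (fun ω => ∫ s in Ioc (0 : ℝ) t, fwdIntegrand α β s ω) ∧
      IsL2ImproperRiemannIntegral P (invIntegrand α β) (fun _ => (t : ℝ)) (fun r => r) atTop
        (fun ω => ∫ s in Ioi (t : ℝ), invIntegrand α β s ω)) ∧
    -- the transformation is an automorphism of the coordinate space, with the stated inverse
    ∃ Z : PathSpace ≃ᵐ PathSpace,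
      MeasurePreserving Z P P ∧
      (∀ᵐ ω ∂P, ∀ t : ℝ≥0, Z ω t = fwdTransform α β ω t) ∧
      (∀ᵐ ω ∂P, ∀ t : ℝ≥0, Z.symm ω t = invTransform α β ω t) := by
  have hν : 0 < α + 1 / 2 := by linarith
  -- Any `δ` strictly between `0` and `min ν β` would do: `δ < ν` for inverting the filters, `δ < β`
  -- for continuity at time `0`.
  set δ := min (α + 1 / 2) β / 2 with hδdef
  have hmin : 0 < min (α + 1 / 2) β := lt_min hν hβ
  have hδ : 0 < δ := by positivity
  have hδν : δ < α + 1 / 2 := (half_lt_self hmin).trans_le (min_le_left _ _)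
  have hδβ : δ < β := (half_lt_self hmin).trans_le (min_le_right _ _)
  have htemp := hP.ae_mem_temperedPaths hβ hδ
  have hneg : |(-1 : ℝ)| = 1 := by simp
  refine ⟨?_, fun t ht => ⟨hP.isL2ImproperRiemannIntegral_fwdIntegrand hν ht,
    hP.isL2ImproperRiemannIntegral_invIntegrand hν ht⟩, allPassEquiv hneg hδ.le hδν hδβ,
    hP.measurePreserving_allPassPath hβ hneg hδ hδν hδβ, ?_, ?_⟩
  · filter_upwards [htemp] with ω hω t ht
    simp only [fwdIntegrand_eq, invIntegrand_eq]
    have ht' : 0 < (t : ℝ) := ht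
    have hc := continuous_lamperti (β := β) ω.continuous
    exact ⟨(integrableOn_Ioc_rpow_smul_iff ht' ω).2
        (hω.2.integrableOn hneg hδ.le hδν.le hc _),
      (integrableOn_Ioi_rpow_smul_iff ht' ω).2
        (hω.2.integrableOn (by simp) hδ.le hδν.le hc _)⟩
  · filter_upwards [htemp] with ω hω t
    rw [fwdTransform_eq_pathAllPass hβ.ne', ← coe_allPassPath_of_mem hneg hδ.le hδν.le hδβ hω]
    rfl
  · filter_upwards [htemp] with ω hω t
    rw [invTransform_eq_pathAllPass hβ.ne' (by linarith),
      ← coe_allPassPath_of_mem (by simp) hδ.le hδν.le hδβ hω]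
    -- The inverse equivalence has direction `-σ` with `σ = -1`, which is `1` only after rewriting.
    change allPassPath _ (- -1) β δ ω t = _
    rw [neg_neg]
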